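/- Let $d$ be a dimension, $r\ge 0$, $\delta_1,\dots,\delta_d\ge 0$, and let $\sigma$ be a real $d\times d$ matrix such that $a=\sigma\sigma^{*}$ is strictly positive definite. Let $W$ be a standard $d$-dimensional Wiener process under a probability measure $P$ and, for $x\in\mathbb R^d$, let $X^x$ be the solution of $$dX^{x,i}_t=(r-\delta_i)X^{x,i}_t\,dt+\sum_{j=1}^d\sigma_{ij}X^{x,i}_t\,dW^j_t,\qquad X^x_0=x,$$ that is, $X^{x,i}_t=x_i\exp\big((r-\delta_i-a_{ii}/2)t+\sum_{j}\sigma_{ij}W^j_t\big)$. Put $D=\{x\in\mathbb R^d: x_i>0,\ i=1,\dots,d\}$ and $$L_{BS}=\sum_{i=1}^d(r-\delta_i)x_i\partial_{x_i}+\frac12\sum_{i,j=1}^d a_{ij}x_ix_j\partial^2_{x_ix_j}.$$ Let $\psi:\mathbb R^d\to\mathbb R$. When $\psi$ is convex, it has first and second order derivatives almost everywhere (the latter in the sense of Alexandrov's theorem, i.e. as coefficients of a second order expansion with remainder $o(|y-x|^2)$); let $\Psi=-r\psi+L_{BS}\psi$, computed a.e. with these pointwise derivatives, $\Psi^-=\max\{-\Psi,0\}$,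 and $\Phi(x,y)=\Psi^-(x)\mathbf 1_{(-\infty,\psi(x)]}(y)$. Assume: (A1) $\psi$ is nonnegative, convex and Lipschitz continuous on $\mathbb R^d$; (A2) for every $x\in D$, $\lim_{t\to\infty}E\,e^{-rt}\psi(X^x_t)=0$ and $E\int_0^\infty e^{-rt}\Psi^-(X^x_t)\,dt<\infty$; (linear growth of $\Psi^-$) there is $c>0$ such that $\Psi^-(x)\le c(1+|x|)$ for a.e. $x\in\mathbb R^d$. Let $\gamma>(2+d)/4$, $\varrho(x)=(1+|x|^2)^{-\gamma}$, $L^2_\varrho(D)=L^2(D;\varrho^2\,dx)$, and let $H^1_\varrho(D)$ be the space of $u\in L^2_\varrho(D)$ with weak derivatives such that $\sum_{j}\sigma_{ij}x_j\partial_{x_j}u\in L^2_\varrho(D)$ for $i=1,\dots,d$. Let $B^{BS}_\varrho$ be the bilinear form on $H^1_\varrho(D)\times H^1_\varrho(D)$ given (with weak derivatives) by $$B^{BS}_\varrho(u,\varphi)=\sum_{i=1}^d\int_D(r-\delta_i)x_i\,\partial_{x_i}u\,\varphi\,\varrho^2\,dx-\frac12\sum_{i,j=1}^d\int_D a_{ij}\,\partial_{x_i}u\,\partial_{x_j}(x_ix_j\varphi\varrho^2)\,dx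 .$$ A function $v\in H^1_\varrho(D)$ is called a variational solution of $L_{BS}v=rv-\Phi(\cdot,v)$, $v\ge\psi$, if $v\ge\psi$ a.e. in $D$, $\Phi(\cdot,v)\in L^2_\varrho(D)$, and $B^{BS}_\varrho(v,\varphi)=(rv-\Phi(\cdot,v),\varphi)_{L^2_\varrho(D)}$ for every $\varphi\in H^1_\varrho(D)$. Then every variational solution $v$ belongs to $H^2_{loc}(D)$, i.e. $v\in H^2(U)$ for every open $U$ whose closure is a compact subset of $D$. Moreover, $v$ has weak first and second order derivatives on $D$, and with these $$L_{BS}v(x)=rv(x)-\Phi(x,v(x))\qquad\text{for a.e. }x\in D.$$ -/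

import Mathlib

open MeasureTheory ProbabilityTheory Filter Topology Asymptotics
open scoped NNReal ENNReal Matrix

noncomputable section

namespace BlackScholes

/-- The Euclidean space of dimension `d`. -/
abbrev Space (d : ℕ) := EuclideanSpace ℝ (Fin d)

/-- The `i`-th standard basis vector. -/
def basisVec {d : ℕ} (i : Fin d) : Space d := EuclideanSpace.single i 1

/-- The open orthant of points with positive coordinates. -/
def orthant (d : ℕ) : Set (Space d) := {x | ∀ i, 0 < x i}

/-- The parameters of a multidimensional Black-Scholes market: interest rate `r`, dividend rates
`δ` and volatility matrix `σ`, with `σ σᵀ` strictly positive definite. -/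
structure Market (d : ℕ) where
  r : ℝ
  δ : Fin d → ℝ
  σ : Matrix (Fin d) (Fin d) ℝ
  r_nonneg : 0 ≤ r
  δ_nonneg : ∀ i, 0 ≤ δ i
  posDef : (σ * σᵀ).PosDef

/-- The covariance matrix `a = σ σᵀ`. -/
def Market.a {d : ℕ} (M : Market d) : Matrix (Fin d) (Fin d) ℝ := M.σ * M.σᵀ

/-! ### The price process -/

/-- A standard `d`-dimensional Wiener process: independent one-dimensional Brownian motions. -/
structure IsWiener {d : ℕ} {Ω : Type*} [MeasurableSpace Ω] (W : Fin d → ℝ≥0 → Ω → ℝ)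
    (P : Measure Ω) : Prop where
  brownian : ∀ i, IsBrownianReal (W i) P
  indep : iIndepFun (fun i ω t => W i t ω) P

/-- The price process started at `x` at time `0`, i.e. the unique solution of
`dXⁱ = (r - δᵢ) Xⁱ dt + ∑ⱼ σᵢⱼ Xⁱ dWʲ`, `X₀ = x`. -/
def Market.price {d : ℕ} (M : Market d) {Ω : Type*} (W : Fin d → ℝ≥0 → Ω → ℝ)
    (x : Space d) (t : ℝ≥0) (ω : Ω) : Space d :=
  WithLp.toLp 2 fun i =>
    x i * Real.exp ((M.r - M.δ i - M.a i i / 2) * (t : ℝ) + ∑ j, M.σ i j * W j t ω)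

/-! ### The payoff function -/

/-- `ψ` is nonnegative, convex and Lipschitz continuous. -/
structure IsPayoff {d : ℕ} (ψ : Space d → ℝ) : Prop where
  nonneg : ∀ x, 0 ≤ ψ x
  convex : ConvexOn ℝ Set.univ ψ
  lipschitz : ∃ L : ℝ, 0 < L ∧ ∀ x y, |ψ x - ψ y| ≤ L * ‖x - y‖

/-- `A` is the matrix of second order derivatives of `ψ` at `x` in the sense of Alexandrov's
theorem: `A` is symmetric and
`ψ(y) = ψ(x) + ∇ψ(x)·(y - x) + (y - x)·A(y - x)/2 + o(|y - x|²)` as `y → x`. -/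
def HasAlexandrovHessianAt {d : ℕ} (ψ : Space d → ℝ) (x : Space d)
    (A : Matrix (Fin d) (Fin d) ℝ) : Prop :=
  A.IsSymm ∧
    (fun y : Space d => ψ y - ψ x - fderiv ℝ ψ x (y - x)
        - (1 / 2) * ∑ i, ∑ j, A i j * (y i - x i) * (y j - x j))
      =o[𝓝 x] fun y => ‖y - x‖ ^ 2

open Classical in
/-- The Alexandrov second order derivatives of `ψ` at `x`; a convex `ψ` has them at almost every
`x`, and the value on the exceptional null set is irrelevant. -/
def alexandrovHessian {d : ℕ} (ψ : Space d → ℝ) (x : Space d) : Matrix (Fin d) (Fin d) ℝ :=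
  if h : ∃ A, HasAlexandrovHessianAt ψ x A then h.choose else 0

/-- The Black-Scholes operator at the point `x`, applied to a vector `p` of first order and a
matrix `A` of second order derivatives. -/
def Market.op {d : ℕ} (M : Market d) (x : Space d) (p : Fin d → ℝ)
    (A : Fin d → Fin d → ℝ) : ℝ :=
  (∑ i, (M.r - M.δ i) * x i * p i) + (1 / 2) * ∑ i, ∑ j, M.a i j * x i * x j * A i j

/-- `Ψ = - r ψ + L ψ`, with pointwise derivatives of `ψ`. -/
def Market.Psi {d : ℕ} (M : Market d) (ψ : Space d → ℝ) (x : Space d) : ℝ :=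
  -M.r * ψ x + M.op x (fun i => fderiv ℝ ψ x (basisVec i)) (alexandrovHessian ψ x)

/-- The negative part `Ψ⁻`. -/
def Market.PsiNeg {d : ℕ} (M : Market d) (ψ : Space d → ℝ) (x : Space d) : ℝ :=
  max (-M.Psi ψ x) 0

/-- `Φ(x, y) = Ψ⁻(x)` if `y ≤ ψ(x)`, and `0` otherwise. -/
def Market.Phi {d : ℕ} (M : Market d) (ψ : Space d → ℝ) (x : Space d) (y : ℝ) : ℝ :=
  (Set.Iic (ψ x)).indicator (fun _ => M.PsiNeg ψ x) y

/-- For every `x` in the orthant, `E e^{-rt} ψ(X_t) → 0` as `t → ∞`, and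
`E ∫₀^∞ e^{-rt} Ψ⁻(X_t) dt < ∞`, where `X` is the price process started at `x`. -/
structure Market.Discounted {d : ℕ} (M : Market d) (ψ : Space d → ℝ) {Ω : Type*}
    [MeasurableSpace Ω] (P : Measure Ω) (W : Fin d → ℝ≥0 → Ω → ℝ) : Prop where
  tendsto_zero : ∀ x ∈ orthant d, Tendsto
    (fun t : ℝ≥0 => ∫ ω, Real.exp (-M.r * (t : ℝ)) * ψ (M.price W x t ω) ∂P) atTop (𝓝 0)
  lintegral_lt_top : ∀ x ∈ orthant d,
    (∫⁻ ω, (∫⁻ t in Set.Ioi (0 : ℝ),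
      ENNReal.ofReal (Real.exp (-M.r * t) * M.PsiNeg ψ (M.price W x t.toNNReal ω))) ∂P) < ⊤

/-- `Ψ⁻(x) ≤ c (1 + |x|)`; as `Ψ` is only defined almost everywhere, so is the inequality. -/
def Market.LinearGrowth {d : ℕ} (M : Market d) (ψ : Space d → ℝ) : Prop :=
  ∃ c : ℝ, 0 < c ∧ ∀ᵐ x : Space d, M.PsiNeg ψ x ≤ c * (1 + ‖x‖)

/-! ### Weak derivatives and Sobolev spaces -/

/-- On the open set `U`, the locally integrable function `g` is the weak (distributional) partial
derivative in direction `i` of the locally integrable function `u`. -/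
structure HasWeakPartial {d : ℕ} (U : Set (Space d)) (i : Fin d) (u g : Space d → ℝ) : Prop where
  locallyIntegrableOn : LocallyIntegrableOn u U
  locallyIntegrableOn_deriv : LocallyIntegrableOn g U
  integral_eq : ∀ φ : Space d → ℝ, ContDiff ℝ (⊤ : ℕ∞) φ → HasCompactSupport φ → tsupport φ ⊆ U →
    (∫ x in U, u x * fderiv ℝ φ x (basisVec i)) = -(∫ x in U, g x * φ x)

/-- The Sobolev space `H²(U)`. -/
def MemH2 {d : ℕ} (U : Set (Space d)) (u : Space d → ℝ) : Prop :=
  MemLp u 2 (volume.restrict U) ∧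
    ∃ (g : Fin d → Space d → ℝ) (h : Fin d → Fin d → Space d → ℝ),
      (∀ i, HasWeakPartial U i u (g i) ∧ MemLp (g i) 2 (volume.restrict U)) ∧
      ∀ i j, HasWeakPartial U j (g i) (h i j) ∧ MemLp (h i j) 2 (volume.restrict U)

/-- The local Sobolev space `H²_loc(D)`: membership in `H²(U)` for every open `U` whose closure is
a compact subset of `D`. -/
def MemH2Loc {d : ℕ} (D : Set (Space d)) (u : Space d → ℝ) : Prop :=
  ∀ U : Set (Space d), IsOpen U → IsCompact (closure U) → closure U ⊆ D → MemH2 U u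

/-! ### Weighted spaces and variational solutions -/

/-- The weight `ϱ(x) = (1 + |x|²)^{-γ}`. -/
def weight {d : ℕ} (γ : ℝ) (x : Space d) : ℝ := (1 + ‖x‖ ^ 2) ^ (-γ)

/-- `u ∈ L²(D; ϱ² dx)` for `D` the open orthant, i.e. `ϱ u ∈ L²(D)`. -/
def MemL2w {d : ℕ} (γ : ℝ) (u : Space d → ℝ) : Prop :=
  MemLp (fun x => weight γ x * u x) 2 (volume.restrict (orthant d))

/-- `u` belongs to the weighted Sobolev space `H¹_ϱ(D)` and `g` is its weak gradient: `u` and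
`∑ⱼ σᵢⱼ xⱼ ∂ⱼu`, `i = 1, …, d`, are in `L²(D; ϱ² dx)`. -/
structure Market.HasH1w {d : ℕ} (M : Market d) (γ : ℝ) (u : Space d → ℝ)
    (g : Fin d → Space d → ℝ) : Prop where
  memL2w : MemL2w γ u
  weakPartial : ∀ i, HasWeakPartial (orthant d) i u (g i)
  memL2w_grad : ∀ i, MemL2w γ fun x => ∑ j, M.σ i j * x j * g j x

/-- The Black-Scholes bilinear form `B_ϱ(u, φ)`, where `g` and `q` are the weak gradients of `u`
and `φ`:
`∑ᵢ ∫ (r - δᵢ) xᵢ ∂ᵢu φ ϱ² dx - ½ ∑ᵢⱼ ∫ aᵢⱼ ∂ᵢu ∂ⱼ(xᵢ xⱼ φ ϱ²) dx`,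
with `∂ⱼ(xᵢ xⱼ φ ϱ²) = xᵢ xⱼ ϱ² ∂ⱼφ + φ ∂ⱼ(xᵢ xⱼ ϱ²)`. Every integrand is, up to a bounded factor,
a product of two of the functions `ϱ u, ϱ φ, ϱ xᵢ ∂ᵢu, ϱ xⱼ ∂ⱼφ`, so this is the continuous extension
to `H¹_ϱ(D) × H¹_ϱ(D)` of the form given by the same formula on smooth functions. -/
def Market.form {d : ℕ} (M : Market d) (γ : ℝ) (g : Fin d → Space d → ℝ)
    (φ : Space d → ℝ) (q : Fin d → Space d → ℝ) : ℝ :=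
  (∑ i, (∫ x in orthant d, (M.r - M.δ i) * x i * g i x * φ x * weight γ x ^ 2))
    - (1 / 2) * ∑ i, ∑ j, (∫ x in orthant d, M.a i j * g i x *
        (x i * x j * weight γ x ^ 2 * q j x
          + φ x * fderiv ℝ (fun y : Space d => y i * y j * weight γ y ^ 2) x (basisVec j)))

/-- `v ∈ H¹_ϱ(D)` is a variational solution of `L v = r v - Φ(·, v)`, `v ≥ ψ`: one has `v ≥ ψ` in
`D`, `Φ(·, v) ∈ L²(D; ϱ² dx)` and `B_ϱ(v, φ) = (r v - Φ(·, v), φ)` in `L²(D; ϱ² dx)` for every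
`φ ∈ H¹_ϱ(D)`. -/
def Market.IsVariationalSolution {d : ℕ} (M : Market d) (γ : ℝ) (ψ v : Space d → ℝ) : Prop :=
  ∃ g : Fin d → Space d → ℝ, M.HasH1w γ v g ∧
    (∀ᵐ x ∂volume.restrict (orthant d), ψ x ≤ v x) ∧
    (MemL2w γ fun x => M.Phi ψ x (v x)) ∧
    ∀ (φ : Space d → ℝ) (q : Fin d → Space d → ℝ), M.HasH1w γ φ q →
      M.form γ g φ q =
        ∫ x in orthant d, (M.r * v x - M.Phi ψ x (v x)) * φ x * weight γ x ^ 2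

end BlackScholes

end

/-!
In the logarithmic coordinates `yᵢ = log xᵢ` the operator `L_BS` has constant coefficients:
`xᵢ ∂ᵢ` becomes `∂ᵢ`, and the orthant `D` becomes the whole space. The theorem is therefore interior
`L²` regularity for a constant coefficient elliptic equation with a locally square integrable
right-hand side; both `v` and `Φ(·, v)` are locally square integrable on `D` because the weight is
continuous and positive.

Test functions `χ / ϱ²` with `χ` smooth of compact support in `D` turn the variational equation into
the equation for `w = v ∘ exp` (`Market.form_eq_logarithmic`). Multiplying `w` by a cutoff function
`η` gives `u = η w ∈ L²` such that `∑ aᵢⱼ ∂ᵢ∂ⱼu` is in `L²`, where the commutator terms contain only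
first derivatives of `w` (`integral_cutoff_mul_partialDeriv_partialDeriv`). On the Fourier side,
`ξᵢ ξⱼ / (1 + ∑ aₖₗ ξₖ ξₗ)` is a bounded multiplier, since `a` is positive definite, and it maps
`u` minus a multiple of `∑ aᵢⱼ ∂ᵢ∂ⱼu` to a multiple of `∂ᵢ∂ⱼu`; so all second derivatives of `u`
are in `L²` (`memSobolev_zero_lineDerivOp_lineDerivOp`). They are glued over an exhaustion by balls
(`exists_memL2loc_second_weak_derivative`) and carried back to `D`
(`hasWeakPartial_orthant_of_integral_comp_expMap`). Once second weak derivatives exist, the weak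
equation becomes an equation almost everywhere.
-/

noncomputable section

namespace BlackScholes

/-! ### Elliptic regularity by Fourier multipliers -/

/-- The partial derivative of `f` in direction `i`. -/
abbrev partialDeriv {d : ℕ} (i : Fin d) (f : Space d → ℝ) : Space d → ℝ :=
  fun x => fderiv ℝ f x (basisVec i)

section Ellipticity

open TemperedDistribution
open scoped SchwartzMap LineDeriv

variable {d : ℕ}

theorem lineDerivOp_lineDerivOp_eq_fourierMultiplierCLM (T : 𝓢'(Space d, ℂ)) (i j : Fin d) :
    ∂_{basisVec i} (∂_{basisVec j} T) = ((2 * Real.pi * Complex.I) ^ 2 : ℂ) •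
      fourierMultiplierCLM ℂ (fun ξ : Space d => ((ξ i * ξ j : ℝ) : ℂ)) T := by
  have hi (k : Fin d) : (fun ξ : Space d => ((inner ℝ ξ (basisVec k) : ℝ) : ℂ)) =
      fun ξ => ((ξ k : ℝ) : ℂ) := by
    ext ξ; simp [basisVec, PiLp.inner_apply]
  have ht (k : Fin d) : (fun ξ : Space d => ((ξ k : ℝ) : ℂ)).HasTemperateGrowth := by
    rw [← hi]; fun_prop
  rw [lineDeriv_eq_fourierMultiplierCLM, lineDeriv_eq_fourierMultiplierCLM, hi, hi, map_smul,
    fourierMultiplierCLM_fourierMultiplierCLM_apply (ht j) (ht i), smul_smul, ← pow_two]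
  congr 3
  ext ξ
  simp [mul_comm]

/-- Elliptic regularity on the level of tempered distributions: if `T` and
`∑ aᵢⱼ ∂ᵢ∂ⱼ T` are square integrable, then so is every `∂ᵢ∂ⱼ T`. The ellipticity of `a` enters as
`∑ aᵢⱼ ξᵢ ξⱼ = |B ξ|²` with an injective `B`, so that `ξᵢ ξⱼ / (1 + |B ξ|²)` is a bounded Fourier
multiplier. -/
theorem memSobolev_zero_lineDerivOp_lineDerivOp {a : Matrix (Fin d) (Fin d) ℝ}
    (B : Space d →L[ℝ] Space d) (hinj : Function.Injective B)
    (hB : ∀ ξ : Space d, ∑ i, ∑ j, a i j * (ξ i * ξ j) = ‖B ξ‖ ^ 2)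
    {T : 𝓢'(Space d, ℂ)} (hT : MemSobolev 0 2 T)
    (hT' : MemSobolev 0 2 (∑ i, ∑ j, (a i j : ℂ) • ∂_{basisVec i} (∂_{basisVec j} T)))
    (i j : Fin d) : MemSobolev 0 2 (∂_{basisVec i} (∂_{basisVec j} T)) := by
  have ht (k l : Fin d) : (fun ξ : Space d => ((ξ k * ξ l : ℝ) : ℂ)).HasTemperateGrowth := by
    have h (k : Fin d) : (fun ξ : Space d => ξ k).HasTemperateGrowth :=
      (EuclideanSpace.proj (𝕜 := ℝ) k : Space d →L[ℝ] ℝ).hasTemperateGrowth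
    have := (h k).mul (h l)
    exact Function.HasTemperateGrowth.comp (g := Complex.ofReal) (by fun_prop) this
  have hq (s : ℝ) : (fun ξ : Space d =>
      (((1 + ‖B ξ‖ ^ 2) ^ s : ℝ) : ℂ)).HasTemperateGrowth := by
    have h : (fun ξ : Space d => (1 + ‖B ξ‖ ^ 2) ^ s).HasTemperateGrowth :=
      (Function.hasTemperateGrowth_one_add_norm_sq_rpow (Space d) s).comp B.hasTemperateGrowth
    exact Function.HasTemperateGrowth.comp (g := Complex.ofReal) (by fun_prop) h
  have hc : ((2 * Real.pi * Complex.I) ^ 2 : ℂ) ≠ 0 := by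
    simp [Real.pi_ne_zero]
  -- `(1 + |B ξ|²)` applied to `T` is a combination of `T` and the second order expression.
  have hQ : fourierMultiplierCLM ℂ (fun ξ : Space d => (((1 + ‖B ξ‖ ^ 2) ^ (1 : ℝ) : ℝ) : ℂ)) T =
      T + ((2 * Real.pi * Complex.I) ^ 2 : ℂ)⁻¹ •
        ∑ i, ∑ j, (a i j : ℂ) • ∂_{basisVec i} (∂_{basisVec j} T) := by
    have hta (k l : Fin d) :
        ((a k l : ℂ) • fun ξ : Space d => ((ξ k * ξ l : ℝ) : ℂ)).HasTemperateGrowth :=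
      (Function.HasTemperateGrowth.const (a k l : ℂ)).mul (ht k l)
    have h1 : (fun ξ : Space d => (((1 + ‖B ξ‖ ^ 2) ^ (1 : ℝ) : ℝ) : ℂ)) =
        fun ξ => ∑ o : Option (Fin d × Fin d), (o.elim (fun _ => 1)
          fun p => (a p.1 p.2 : ℂ) • fun ξ : Space d => ((ξ p.1 * ξ p.2 : ℝ) : ℂ)) ξ := by
      ext ξ
      rw [Real.rpow_one, ← hB, Fintype.sum_option, Fintype.sum_prod_type]
      simp
    rw [h1, fourierMultiplierCLM_sum]
    · rw [Fintype.sum_option, Fintype.sum_prod_type]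
      simp only [Option.elim_none, Option.elim_some, add_apply,
        sum_apply, fourierMultiplierCLM_const, one_smul,
        ContinuousLinearMap.id_apply, Finset.smul_sum]
      congr 1
      refine Finset.sum_congr rfl fun k _ => Finset.sum_congr rfl fun l _ => ?_
      rw [fourierMultiplierCLM_smul (ht k l), lineDerivOp_lineDerivOp_eq_fourierMultiplierCLM,
        smul_comm, smul_smul _ _ (fourierMultiplierCLM ℂ _ T), inv_mul_cancel₀ hc, one_smul]
      rfl
    · rintro (_ | p) -
      · exact Function.HasTemperateGrowth.const 1
      · exact hta _ _
  have hQS : MemSobolev 0 2 (fourierMultiplierCLM ℂ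
      (fun ξ : Space d => (((1 + ‖B ξ‖ ^ 2) ^ (1 : ℝ) : ℝ) : ℂ)) T) := by
    rw [hQ]; exact hT.add (hT'.smul _)
  -- `ξᵢ ξⱼ` factors through `1 + |B ξ|²` with a bounded quotient.
  have hm : (fun ξ : Space d => ((ξ i * ξ j : ℝ) : ℂ)) =
      (fun ξ : Space d => (((1 + ‖B ξ‖ ^ 2) ^ (1 : ℝ) : ℝ) : ℂ)) *
      ((fun ξ : Space d => ((ξ i * ξ j : ℝ) : ℂ)) *
        fun ξ : Space d => (((1 + ‖B ξ‖ ^ 2) ^ (-1 : ℝ) : ℝ) : ℂ)) := by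
    ext ξ
    simp only [Pi.mul_apply]
    rw [← Complex.ofReal_mul, ← Complex.ofReal_mul]
    congr 1
    rw [Real.rpow_neg (by positivity), Real.rpow_one]
    have : (1 + ‖B ξ‖ ^ 2) ≠ 0 := by positivity
    field_simp
  obtain ⟨K, hK⟩ := (B : Space d →ₗ[ℝ] Space d).exists_antilipschitzWith
    (LinearMap.ker_eq_bot.2 hinj)
  rw [lineDerivOp_lineDerivOp_eq_fourierMultiplierCLM, hm,
    ← fourierMultiplierCLM_fourierMultiplierCLM_apply (hq 1) ((ht i j).mul (hq (-1)))]
  refine (hQS.fourierMultiplierCLM_of_bounded ((ht i j).mul (hq (-1))) ⟨K ^ 2, fun ξ => ?_⟩).smul _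
  have h0 : ‖ξ‖ ≤ K * ‖B ξ‖ := by simpa using hK.2.le_mul_norm_sub 0 ξ
  have hi (k : Fin d) : |ξ k| ≤ ‖ξ‖ := PiLp.norm_apply_le ξ k
  simp only [Pi.mul_apply]
  rw [← Complex.ofReal_mul, Complex.norm_real, Real.norm_eq_abs, Real.rpow_neg (by positivity),
    Real.rpow_one, ← div_eq_mul_inv, abs_div, abs_of_pos (by positivity : 0 < 1 + ‖B ξ‖ ^ 2),
    div_le_iff₀ (by positivity), abs_mul]
  calc |ξ i| * |ξ j| ≤ ‖ξ‖ * ‖ξ‖ := by gcongr <;> apply hi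
    _ ≤ (K * ‖B ξ‖) * (K * ‖B ξ‖) := by gcongr
    _ ≤ K ^ 2 * (1 + ‖B ξ‖ ^ 2) := by nlinarith [sq_nonneg (K : ℝ)]

theorem partialDeriv_comp_schwartz (L : ℂ →L[ℝ] ℝ) (θ : 𝓢(Space d, ℂ)) (i : Fin d) :
    partialDeriv i (fun x => L (θ x)) = fun x => L ((∂_{basisVec i} θ : 𝓢(Space d, ℂ)) x) := by
  ext x
  have h := L.hasFDerivAt.comp x (θ.hasFDerivAt x)
  rw [SchwartzMap.lineDerivOp_apply_eq_fderiv, partialDeriv]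
  erw [h.fderiv]
  rfl

theorem partialDeriv_partialDeriv_comp_schwartz (L : ℂ →L[ℝ] ℝ) (θ : 𝓢(Space d, ℂ))
    (i j : Fin d) : partialDeriv j (partialDeriv i fun x => L (θ x)) =
      fun x => L ((∂_{basisVec j} (∂_{basisVec i} θ) : 𝓢(Space d, ℂ)) x) := by
  rw [partialDeriv_comp_schwartz, partialDeriv_comp_schwartz]

/-- The pairing of a real square integrable function with a complex Schwartz function is computed
on the real and imaginary parts of the latter. -/
theorem clm_integral_smul_toLp {u : Space d → ℝ} (hu : MemLp (fun x => (u x : ℂ)) 2 volume)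
    (L : ℂ →L[ℝ] ℝ) (θ : 𝓢(Space d, ℂ)) :
    L ((hu.toLp _ : 𝓢'(Space d, ℂ)) θ) = ∫ x, u x * L (θ x) := by
  rw [Lp.toTemperedDistribution_apply]
  have h0 : Integrable (fun x => θ x * (u x : ℂ)) := (θ.memLp 2).integrable_mul hu
  have h1 : (∫ x, θ x • (hu.toLp _ : Lp ℂ 2 volume) x) = ∫ x, θ x * (u x : ℂ) := by
    refine integral_congr_ae ?_
    filter_upwards [hu.coeFn_toLp] with x hx
    rw [hx, smul_eq_mul]
  rw [h1, ← L.integral_comp_comm h0]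
  refine integral_congr_ae (Eventually.of_forall fun x => ?_)
  have : θ x * (u x : ℂ) = u x • θ x := by rw [Complex.real_smul, mul_comm]
  simp only [this, map_smul, smul_eq_mul]

/-- Elliptic regularity for functions: if `u` and `∑ aᵢⱼ ∂ⱼ∂ᵢ u` (in the sense of distributions)
are square integrable, then all second order distributional derivatives of `u` are. -/
theorem exists_memLp_integral_partialDeriv_partialDeriv {a : Matrix (Fin d) (Fin d) ℝ}
    (B : Space d →L[ℝ] Space d) (hinj : Function.Injective B)
    (hB : ∀ ξ : Space d, ∑ i, ∑ j, a i j * (ξ i * ξ j) = ‖B ξ‖ ^ 2)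
    {u F : Space d → ℝ} (hu : MemLp u 2 volume) (hF : MemLp F 2 volume)
    (h : ∀ θ : Space d → ℝ, ContDiff ℝ (⊤ : ℕ∞) θ →
      ∫ x, u x * ∑ i, ∑ j, a i j * partialDeriv j (partialDeriv i θ) x = ∫ x, F x * θ x)
    (i j : Fin d) :
    ∃ H : Space d → ℝ, MemLp H 2 volume ∧ ∀ θ : Space d → ℝ, ContDiff ℝ (⊤ : ℕ∞) θ →
      HasCompactSupport θ →
      ∫ x, u x * partialDeriv j (partialDeriv i θ) x = ∫ x, H x * θ x := by
  have hu' : MemLp (fun x => (u x : ℂ)) 2 volume := hu.ofReal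
  have hF' : MemLp (fun x => (F x : ℂ)) 2 volume := hF.ofReal
  set T : 𝓢'(Space d, ℂ) := (hu'.toLp _ : 𝓢'(Space d, ℂ)) with hTdef
  have hT : MemSobolev 0 2 T := memSobolev_zero_iff.2 ⟨_, rfl⟩
  have hsum : (∑ i, ∑ j, (a i j : ℂ) • ∂_{basisVec i} (∂_{basisVec j} T)) =
      (hF'.toLp _ : 𝓢'(Space d, ℂ)) := by
    ext θ
    have key (L : ℂ →L[ℝ] ℝ) :
        L ((∑ i, ∑ j, (a i j : ℂ) • ∂_{basisVec i} (∂_{basisVec j} T)) θ) =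
          L ((hF'.toLp _ : 𝓢'(Space d, ℂ)) θ) := by
      have e1 : (∑ i, ∑ j, (a i j : ℂ) • ∂_{basisVec i} (∂_{basisVec j} T)) θ =
          T (∑ i, ∑ j, (a i j : ℂ) • (∂_{basisVec j} (∂_{basisVec i} θ) : 𝓢(Space d, ℂ))) := by
        simp [lineDerivOp_apply_apply, sum_apply, -Complex.coe_smul]
      rw [e1, clm_integral_smul_toLp, clm_integral_smul_toLp, ← h]
      · refine integral_congr_ae (Eventually.of_forall fun x => ?_)
        have e3 (k l : Fin d) := congrFun (partialDeriv_partialDeriv_comp_schwartz L θ k l) x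
        have e2 (z : ℂ) (r : ℝ) : L ((r : ℂ) * z) = r * L z := by
          rw [← Complex.real_smul, map_smul, smul_eq_mul]
        simp only [e3]
        simp [sum_apply, map_sum, e2, -Complex.coe_smul]
      · exact L.contDiff.comp (θ.smooth _)
    exact Complex.ext (key Complex.reCLM) (key Complex.imCLM)
  obtain ⟨H, hH⟩ := memSobolev_zero_iff.1 (memSobolev_zero_lineDerivOp_lineDerivOp B hinj hB hT
    (memSobolev_zero_iff.2 ⟨_, hsum⟩) i j)
  refine ⟨fun x => (H x).re, (Lp.memLp H).re, fun θ hθ hc => ?_⟩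
  have hc' : HasCompactSupport fun x => (θ x : ℂ) := hc.comp_left (g := Complex.ofReal) (by simp)
  set Θ : 𝓢(Space d, ℂ) := hc'.toSchwartzMap (Complex.ofRealCLM.contDiff.comp hθ) with hΘ
  have hΘx (x) : Θ x = θ x := rfl
  have e := congrArg (fun S : 𝓢'(Space d, ℂ) => Complex.reCLM (S Θ)) hH
  simp only [lineDerivOp_apply_apply, map_neg, neg_neg, hTdef] at e
  rw [clm_integral_smul_toLp] at e
  have e3 : θ = fun x => Complex.reCLM (Θ x) := by ext x; simp [hΘx]
  have e4 : partialDeriv j (partialDeriv i θ) =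
      fun x => Complex.reCLM ((∂_{basisVec j} (∂_{basisVec i} Θ) : 𝓢(Space d, ℂ)) x) := by
    rw [e3, partialDeriv_partialDeriv_comp_schwartz]
  rw [e4, e, Lp.toTemperedDistribution_apply]
  have h0 : Integrable (fun x => Θ x • H x) := (Θ.memLp 2).integrable_mul (Lp.memLp H)
  rw [← Complex.reCLM.integral_comp_comm h0]
  refine integral_congr_ae (Eventually.of_forall fun x => ?_)
  simp [hΘx, mul_comm]

end Ellipticity

/-! ### Locally square integrable functions and localization -/

/-- `u` is square integrable on every compact subset of `U`. -/
def MemL2loc {d : ℕ} (U : Set (Space d)) (u : Space d → ℝ) : Prop :=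
  ∀ K ⊆ U, IsCompact K → MemLp u 2 (volume.restrict K)

/-- Smooth functions with compact support. -/
structure IsTest {d : ℕ} (φ : Space d → ℝ) : Prop where
  smooth : ContDiff ℝ (⊤ : ℕ∞) φ
  compact : HasCompactSupport φ

variable {d : ℕ}

theorem MemL2loc.integrableOn {U : Set (Space d)} {u : Space d → ℝ} (hu : MemL2loc U u)
    {K : Set (Space d)} (hKU : K ⊆ U) (hK : IsCompact K) : IntegrableOn u K := by
  have : IsFiniteMeasure (volume.restrict K) := isFiniteMeasure_restrict.2 hK.measure_lt_top.ne
  exact (hu K hKU hK).integrable one_le_two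

theorem MemL2loc.locallyIntegrableOn {U : Set (Space d)} (hU : IsOpen U) {u : Space d → ℝ}
    (hu : MemL2loc U u) : LocallyIntegrableOn u U :=
  (locallyIntegrableOn_iff hU.isLocallyClosed).2 fun _ hKU hK => hu.integrableOn hKU hK

theorem MemL2loc.locallyIntegrable {u : Space d → ℝ} (hu : MemL2loc Set.univ u) :
    LocallyIntegrable u :=
  locallyIntegrableOn_univ.1 (hu.locallyIntegrableOn isOpen_univ)

theorem MemL2loc.add {U : Set (Space d)} {u v : Space d → ℝ} (hu : MemL2loc U u)
    (hv : MemL2loc U v) : MemL2loc U fun x => u x + v x :=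
  fun K hKU hK => (hu K hKU hK).add (hv K hKU hK)

theorem MemL2loc.const_mul {U : Set (Space d)} {u : Space d → ℝ} (hu : MemL2loc U u) (c : ℝ) :
    MemL2loc U fun x => c * u x :=
  fun K hKU hK => (hu K hKU hK).const_mul c

theorem MemL2loc.sum {U : Set (Space d)} {ι : Type*} {s : Finset ι} {u : ι → Space d → ℝ}
    (hu : ∀ i, MemL2loc U (u i)) : MemL2loc U fun x => ∑ i ∈ s, u i x :=
  fun K hKU hK => memLp_finsetSum s fun i _ => hu i K hKU hK

theorem MemL2loc.continuousOn_mul {U : Set (Space d)} {u f : Space d → ℝ} (hu : MemL2loc U u)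
    (hf : ContinuousOn f U) : MemL2loc U fun x => f x * u x := by
  intro K hKU hK
  obtain ⟨C, hC⟩ := hK.exists_bound_of_continuousOn (hf.mono hKU)
  refine (hu K hKU hK).of_le_mul (c := C)
    (((hf.mono hKU).aestronglyMeasurable hK.measurableSet).mul (hu K hKU hK).1) ?_
  filter_upwards [ae_restrict_mem hK.measurableSet] with x hx
  rw [norm_mul]
  gcongr
  exact hC x hx

/-- A locally square integrable function becomes square integrable after multiplication by a
continuous function of compact support. -/
theorem MemL2loc.memLp_mul {u φ : Space d → ℝ} (hu : MemL2loc Set.univ u) (hφ : Continuous φ)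
    (hc : HasCompactSupport φ) : MemLp (fun x => φ x * u x) 2 volume := by
  have h := hu.continuousOn_mul hφ.continuousOn _ (Set.subset_univ _) hc.isCompact
  have e : (tsupport φ).indicator (fun x => φ x * u x) = fun x => φ x * u x := by
    rw [Set.indicator_eq_self]
    exact (Function.support_mul_subset_left _ _).trans (subset_tsupport φ)
  rw [← e, memLp_indicator_iff_restrict (isClosed_tsupport φ).measurableSet]
  exact h

theorem MemL2loc.integrable_mul {u φ : Space d → ℝ} (hu : MemL2loc Set.univ u)
    (hφ : Continuous φ) (hc : HasCompactSupport φ) : Integrable fun x => u x * φ x := by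
  simpa only [smul_eq_mul] using
    hu.locallyIntegrable.integrable_smul_right_of_hasCompactSupport hφ hc

theorem integrable_sum_sum_const_mul {α : Type*} [MeasurableSpace α] {μ : Measure α}
    (c : Fin d → Fin d → ℝ) {f : Fin d → Fin d → α → ℝ} (hf : ∀ i j, Integrable (f i j) μ) :
    Integrable (fun x => ∑ i, ∑ j, c i j * f i j x) μ :=
  integrable_finsetSum _ fun i _ => integrable_finsetSum _ fun j _ => (hf i j).const_mul _

theorem integral_sum_sum_const_mul {α : Type*} [MeasurableSpace α] {μ : Measure α}
    (c : Fin d → Fin d → ℝ) {f : Fin d → Fin d → α → ℝ} (hf : ∀ i j, Integrable (f i j) μ) :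
    ∫ x, ∑ i, ∑ j, c i j * f i j x ∂μ = ∑ i, ∑ j, c i j * ∫ x, f i j x ∂μ := by
  rw [integral_finsetSum _ fun i _ => integrable_finsetSum _ fun j _ => (hf i j).const_mul _]
  refine Finset.sum_congr rfl fun i _ => ?_
  rw [integral_finsetSum _ fun j _ => (hf i j).const_mul _]
  simp only [integral_const_mul]

theorem contDiff_partialDeriv {f : Space d → ℝ} (hf : ContDiff ℝ (⊤ : ℕ∞) f) (i : Fin d) :
    ContDiff ℝ (⊤ : ℕ∞) (partialDeriv i f) :=
  (hf.fderiv_right (m := (⊤ : ℕ∞)) (by simp)).clm_apply contDiff_const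

theorem partialDeriv_mul {f g : Space d → ℝ} {x : Space d} (hf : DifferentiableAt ℝ f x)
    (hg : DifferentiableAt ℝ g x) (i : Fin d) :
    partialDeriv i (fun y => f y * g y) x =
      f x * partialDeriv i g x + partialDeriv i f x * g x := by
  simp only [partialDeriv]
  rw [fderiv_fun_mul hf hg]
  simp [mul_comm]

theorem IsTest.continuous {φ : Space d → ℝ} (hφ : IsTest φ) : Continuous φ := hφ.smooth.continuous

theorem tsupport_partialDeriv_subset (f : Space d → ℝ) (i : Fin d) :
    tsupport (partialDeriv i f) ⊆ tsupport f := by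
  refine closure_minimal (fun y hy => ?_) (isClosed_tsupport _)
  by_contra hy'
  exact hy (by simp [BlackScholes.partialDeriv, fderiv_of_notMem_tsupport ℝ hy'])

theorem IsTest.partialDeriv {φ : Space d → ℝ} (hφ : IsTest φ) (i : Fin d) :
    IsTest (partialDeriv i φ) :=
  ⟨contDiff_partialDeriv hφ.smooth i, hφ.compact.fderiv_apply ℝ _⟩

theorem IsTest.mul_right {φ f : Space d → ℝ} (hφ : IsTest φ) (hf : ContDiff ℝ (⊤ : ℕ∞) f) :
    IsTest fun x => φ x * f x :=
  ⟨hφ.smooth.mul hf, hφ.compact.mul_right⟩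

theorem IsTest.mul_left {φ f : Space d → ℝ} (hφ : IsTest φ) (hf : ContDiff ℝ (⊤ : ℕ∞) f) :
    IsTest fun x => f x * φ x :=
  ⟨hf.mul hφ.smooth, hφ.compact.mul_left⟩

theorem MemL2loc.integrable_test {u φ : Space d → ℝ} (hu : MemL2loc Set.univ u)
    (hφ : IsTest φ) : Integrable fun x => u x * φ x :=
  hu.integrable_mul hφ.continuous hφ.compact

/-- Two integrations by parts move the derivatives off `θ` from `η w ∂ⱼ∂ᵢθ`, up to the one term
in which the equation for `w` can be used. -/
theorem integral_cutoff_mul_partialDeriv_partialDeriv {w : Space d → ℝ} {G : Fin d → Space d → ℝ}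
    (hw : MemL2loc Set.univ w) (hG : ∀ i, MemL2loc Set.univ (G i))
    (hwG : ∀ i θ, IsTest θ → ∫ x, w x * partialDeriv i θ x = -∫ x, G i x * θ x)
    {η θ : Space d → ℝ} (hη : IsTest η) (hθ : ContDiff ℝ (⊤ : ℕ∞) θ) (i j : Fin d) :
    ∫ x, η x * w x * partialDeriv j (partialDeriv i θ) x =
      -(∫ x, G j x * partialDeriv i (fun y => η y * θ y) x) +
        ∫ x, (G j x * partialDeriv i η x + G i x * partialDeriv j η x +
          w x * partialDeriv i (partialDeriv j η) x) * θ x := by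
  have dη := hη.smooth.differentiable (by simp)
  have dθ := hθ.differentiable (by simp)
  have dθ' := (contDiff_partialDeriv hθ i).differentiable (by simp)
  have dη' := (hη.partialDeriv j).smooth.differentiable (by simp)
  have t1 := hη.mul_right (contDiff_partialDeriv hθ i)
  have t2 := (hη.partialDeriv j).mul_right hθ
  have e1 : ∫ x, η x * w x * partialDeriv j (partialDeriv i θ) x =
      (∫ x, w x * partialDeriv j (fun y => η y * partialDeriv i θ y) x) -
        ∫ x, w x * (partialDeriv j η x * partialDeriv i θ x) := by
    rw [← integral_sub (hw.integrable_test (t1.partialDeriv j))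
      (hw.integrable_test ((hη.partialDeriv j).mul_right (contDiff_partialDeriv hθ i)))]
    refine integral_congr_ae (Eventually.of_forall fun x => ?_)
    simp only
    rw [partialDeriv_mul (dη x) (dθ' x)]
    ring
  have e2 : ∫ x, w x * (partialDeriv j η x * partialDeriv i θ x) =
      (∫ x, w x * partialDeriv i (fun y => partialDeriv j η y * θ y) x) -
        ∫ x, w x * (partialDeriv i (partialDeriv j η) x * θ x) := by
    rw [← integral_sub (hw.integrable_test (t2.partialDeriv i))
      (hw.integrable_test (((hη.partialDeriv j).partialDeriv i).mul_right hθ))]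
    refine integral_congr_ae (Eventually.of_forall fun x => ?_)
    simp only
    rw [partialDeriv_mul (dη' x) (dθ x)]
    ring
  have e3 : ∫ x, G j x * (η x * partialDeriv i θ x) =
      (∫ x, G j x * partialDeriv i (fun y => η y * θ y) x) -
        ∫ x, G j x * (partialDeriv i η x * θ x) := by
    rw [← integral_sub ((hG j).integrable_test ((hη.mul_right hθ).partialDeriv i))
      ((hG j).integrable_test ((hη.partialDeriv i).mul_right hθ))]
    refine integral_congr_ae (Eventually.of_forall fun x => ?_)
    simp only
    rw [partialDeriv_mul (dη x) (dθ x)]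
    ring
  have e4 : ∫ x, (G j x * partialDeriv i η x + G i x * partialDeriv j η x +
        w x * partialDeriv i (partialDeriv j η) x) * θ x =
      (∫ x, G j x * (partialDeriv i η x * θ x)) + (∫ x, G i x * (partialDeriv j η x * θ x)) +
        ∫ x, w x * (partialDeriv i (partialDeriv j η) x * θ x) := by
    have i1 := (hG j).integrable_test ((hη.partialDeriv i).mul_right hθ)
    have i2 := (hG i).integrable_test ((hη.partialDeriv j).mul_right hθ)
    have i3 := hw.integrable_test (((hη.partialDeriv j).partialDeriv i).mul_right hθ)
    rw [← integral_add i1 i2, ← integral_add (by exact i1.add i2) i3]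
    refine integral_congr_ae (Eventually.of_forall fun x => ?_)
    simp only
    ring
  rw [e1, e2, e4, hwG j _ t1, hwG i _ t2, e3]
  ring

/-- Square integrable densities that represent a functional on test functions supported in larger
and larger balls fit together to one locally square integrable density. -/
theorem exists_memL2loc_of_forall_ball {l : (Space d → ℝ) → ℝ} {H : ℕ → Space d → ℝ}
    (hH : ∀ n, MemLp (H n) 2 volume)
    (hl : ∀ (n : ℕ) θ, IsTest θ → tsupport θ ⊆ Metric.ball 0 n → l θ = ∫ x, H n x * θ x) :
    ∃ h : Space d → ℝ, MemL2loc Set.univ h ∧ ∀ θ, IsTest θ → l θ = ∫ x, h x * θ x := by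
  have hint (n) : LocallyIntegrable (H n) := (hH n).locallyIntegrable one_le_two
  have hae : ∀ n m : ℕ, n ≤ m →
      ∀ᵐ x : Space d, x ∈ Metric.ball (0 : Space d) n → H n x - H m x = 0 := by
    intro n m hnm
    refine Metric.isOpen_ball.ae_eq_zero_of_integral_contDiff_smul_eq_zero
      (((hint n).sub (hint m)).locallyIntegrableOn _) fun θ hθ hc hs => ?_
    have a1 := hl n θ ⟨hθ, hc⟩ hs
    have a2 := hl m θ ⟨hθ, hc⟩ (hs.trans (Metric.ball_subset_ball (by exact_mod_cast hnm)))
    have i1 (k) : Integrable fun x => H k x * θ x := by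
      simpa only [smul_eq_mul] using
        (hint k).integrable_smul_right_of_hasCompactSupport hθ.continuous hc
    calc ∫ x, θ x • (H n x - H m x) = ∫ x, (H n x * θ x - H m x * θ x) := by
          refine integral_congr_ae (Eventually.of_forall fun x => ?_)
          simp only [smul_eq_mul]; ring
      _ = 0 := by rw [integral_sub (i1 n) (i1 m), ← a1, ← a2, sub_self]
  -- Every `x` lies in the ball of radius `⌊‖x‖⌋₊ + 1`, whose density is used at `x`.
  let h : Space d → ℝ := fun x => H (⌊‖x‖⌋₊ + 1) x
  have hae' (m : ℕ) : ∀ᵐ x : Space d, x ∈ Metric.ball (0 : Space d) m → h x = H m x := by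
    have := ae_all_iff.2 fun n => ae_all_iff.2 fun hn : n ≤ m => hae n m hn
    filter_upwards [this] with x hx hxm
    rw [mem_ball_zero_iff] at hxm
    refine sub_eq_zero.1 (hx (⌊‖x‖⌋₊ + 1) ?_ ?_)
    · exact Nat.succ_le_of_lt ((Nat.floor_lt (norm_nonneg x)).2 hxm)
    · rw [mem_ball_zero_iff]; exact_mod_cast Nat.lt_floor_add_one ‖x‖
  have hball {K : Set (Space d)} (hK : IsCompact K) :
      ∃ m : ℕ, K ⊆ Metric.ball (0 : Space d) m := by
    obtain ⟨R, hR⟩ := hK.isBounded.subset_ball 0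
    obtain ⟨m, hm⟩ := exists_nat_ge R
    exact ⟨m, hR.trans (Metric.ball_subset_ball hm)⟩
  refine ⟨h, fun K _ hK => ?_, fun θ hθ => ?_⟩
  · obtain ⟨m, hm⟩ := hball hK
    refine ((hH m).restrict K).ae_eq ?_
    filter_upwards [ae_restrict_of_ae (hae' m), ae_restrict_mem hK.measurableSet] with x hx hxK
    exact (hx (hm hxK)).symm
  · obtain ⟨m, hm⟩ := hball hθ.compact
    rw [hl m θ hθ hm]
    refine integral_congr_ae ?_
    filter_upwards [hae' m] with x hx
    by_cases hxs : x ∈ tsupport θ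
    · rw [hx (hm hxs)]
    · simp [image_eq_zero_of_notMem_tsupport hxs]

/-- Interior elliptic regularity for constant coefficients: if `w` has locally square integrable
weak gradient `G` and `∑ aᵢⱼ ∂ᵢGⱼ` is locally square integrable, then so is every `∂ᵢGⱼ`. -/
theorem exists_memL2loc_second_weak_derivative {a : Matrix (Fin d) (Fin d) ℝ}
    (B : Space d →L[ℝ] Space d) (hinj : Function.Injective B)
    (hB : ∀ ξ : Space d, ∑ i, ∑ j, a i j * (ξ i * ξ j) = ‖B ξ‖ ^ 2)
    {w F : Space d → ℝ} {G : Fin d → Space d → ℝ}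
    (hw : MemL2loc Set.univ w) (hG : ∀ i, MemL2loc Set.univ (G i)) (hF : MemL2loc Set.univ F)
    (hwG : ∀ i θ, IsTest θ → ∫ x, w x * partialDeriv i θ x = -∫ x, G i x * θ x)
    (hGF : ∀ θ, IsTest θ → ∑ i, ∑ j, a i j * ∫ x, G j x * partialDeriv i θ x = ∫ x, F x * θ x)
    (i j : Fin d) :
    ∃ H : Space d → ℝ, MemL2loc Set.univ H ∧
      ∀ θ, IsTest θ → ∫ x, G j x * partialDeriv i θ x = -∫ x, H x * θ x := by
  have key (n : ℕ) : ∃ H : Space d → ℝ, MemLp H 2 volume ∧ ∀ θ, IsTest θ →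
      tsupport θ ⊆ Metric.ball 0 n → ∫ x, G j x * partialDeriv i θ x = ∫ x, H x * θ x := by
    let b : ContDiffBump (0 : Space d) := ⟨n + 1, n + 2, by positivity, by linarith⟩
    have hη : IsTest b := ⟨b.contDiff, b.hasCompactSupport⟩
    set R : Fin d → Fin d → Space d → ℝ := fun k l x => G l x * partialDeriv k b x +
      G k x * partialDeriv l b x + w x * partialDeriv k (partialDeriv l b) x with hR
    have hRL (k l) : MemLp (R k l) 2 volume := by
      have h1 := (hG l).memLp_mul (hη.partialDeriv k).continuous (hη.partialDeriv k).compact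
      have h2 := (hG k).memLp_mul (hη.partialDeriv l).continuous (hη.partialDeriv l).compact
      have h3 := hw.memLp_mul ((hη.partialDeriv l).partialDeriv k).continuous
        ((hη.partialDeriv l).partialDeriv k).compact
      refine ((h1.add h2).add h3).ae_eq (Eventually.of_forall fun x => ?_)
      simp only [Pi.add_apply, hR]
      ring
    have hRi (k l) {θ : Space d → ℝ} (hθ : ContDiff ℝ (⊤ : ℕ∞) θ) :
        Integrable fun x => R k l x * θ x := by
      have h1 := (hG l).integrable_test ((hη.partialDeriv k).mul_right hθ)
      have h2 := (hG k).integrable_test ((hη.partialDeriv l).mul_right hθ)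
      have h3 := hw.integrable_test (((hη.partialDeriv l).partialDeriv k).mul_right hθ)
      refine ((h1.add h2).add h3).congr (Eventually.of_forall fun x => ?_)
      simp only [Pi.add_apply, hR]
      ring
    have hη1 : MemLp (fun x => b x * w x) 2 volume := hw.memLp_mul hη.continuous hη.compact
    have hη2 : MemLp (fun x => b x * F x) 2 volume := hF.memLp_mul hη.continuous hη.compact
    have hloc (θ : Space d → ℝ) (hθ : ContDiff ℝ (⊤ : ℕ∞) θ) :
        ∫ x, b x * w x * ∑ k, ∑ l, a k l * partialDeriv l (partialDeriv k θ) x =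
          ∫ x, ((∑ k, ∑ l, a k l * R k l x) - b x * F x) * θ x := by
      have i1 (k l) : Integrable fun x => b x * w x * partialDeriv l (partialDeriv k θ) x := by
        have := hw.integrable_test (hη.mul_right
          (contDiff_partialDeriv (contDiff_partialDeriv hθ k) l))
        refine this.congr (Eventually.of_forall fun x => ?_)
        simp only
        ring
      calc ∫ x, b x * w x * ∑ k, ∑ l, a k l * partialDeriv l (partialDeriv k θ) x
          = ∫ x, ∑ k, ∑ l, a k l * (b x * w x * partialDeriv l (partialDeriv k θ) x) := by
            refine integral_congr_ae (Eventually.of_forall fun x => ?_)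
            simp only [Finset.mul_sum]
            refine Finset.sum_congr rfl fun k _ => Finset.sum_congr rfl fun l _ => ?_
            ring
        _ = ∑ k, ∑ l, a k l * ∫ x, b x * w x * partialDeriv l (partialDeriv k θ) x := by
            exact integral_sum_sum_const_mul (fun k l => a k l) i1
        _ = -(∑ k, ∑ l, a k l * ∫ x, G l x * partialDeriv k (fun y => b y * θ y) x) +
            ∑ k, ∑ l, a k l * ∫ x, R k l x * θ x := by
            simp only [integral_cutoff_mul_partialDeriv_partialDeriv hw hG hwG hη hθ, hR, mul_add,
              Finset.sum_add_distrib, mul_neg, Finset.sum_neg_distrib]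
        _ = -(∫ x, F x * (b x * θ x)) + ∫ x, ∑ k, ∑ l, a k l * (R k l x * θ x) := by
            rw [hGF _ (hη.mul_right hθ)]
            congr 1
            exact (integral_sum_sum_const_mul (fun k l => a k l) fun k l => hRi k l hθ).symm
        _ = _ := by
            rw [neg_add_eq_sub, ← integral_sub
              (integrable_sum_sum_const_mul (fun k l => a k l) fun k l => hRi k l hθ)
              (hF.integrable_test (hη.mul_right hθ))]
            refine integral_congr_ae (Eventually.of_forall fun x => ?_)
            simp only [sub_mul, Finset.sum_mul]
            congr 1
            · refine Finset.sum_congr rfl fun k _ => Finset.sum_congr rfl fun l _ => ?_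
              ring
            · ring
    obtain ⟨H, hH, hHθ⟩ := exists_memLp_integral_partialDeriv_partialDeriv B hinj hB hη1
      (F := fun x => (∑ k, ∑ l, a k l * R k l x) - b x * F x)
      ((memLp_finsetSum _ fun k _ => memLp_finsetSum _ fun l _ => (hRL k l).const_mul _).sub hη2)
      hloc i j
    refine ⟨fun x => -H x, hH.neg, fun θ hθ hs => ?_⟩
    have h1 := hHθ θ hθ.smooth hθ.compact
    have h2 : ∫ x, b x * w x * partialDeriv j (partialDeriv i θ) x =
        ∫ x, w x * partialDeriv j (partialDeriv i θ) x := by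
      refine integral_congr_ae (Eventually.of_forall fun x => ?_)
      simp only
      by_cases hx : x ∈ tsupport (partialDeriv j (partialDeriv i θ))
      · have hx' : x ∈ Metric.closedBall (0 : Space d) b.rIn := Metric.ball_subset_closedBall
          (Metric.ball_subset_ball (by simp [b]) (hs (tsupport_partialDeriv_subset _ _
            (tsupport_partialDeriv_subset _ _ hx))))
        rw [b.one_of_mem_closedBall hx', one_mul]
      · simp [image_eq_zero_of_notMem_tsupport hx]
    rw [h2, hwG j _ (hθ.partialDeriv i)] at h1
    simp only [neg_mul, integral_neg]
    linarith
  choose H hH hHθ using key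
  obtain ⟨h, hh, hhθ⟩ := exists_memL2loc_of_forall_ball
    (l := fun θ => ∫ x, G j x * partialDeriv i θ x) hH hHθ
  refine ⟨fun x => -h x, fun K hKU hK => (hh K hKU hK).neg, fun θ hθ => ?_⟩
  rw [hhθ θ hθ]
  simp only [neg_mul, integral_neg, neg_neg]

/-! ### Logarithmic coordinates on the orthant -/

/-- The coordinatewise exponential, a diffeomorphism of the whole space onto the open orthant. -/
def expMap (y : Space d) : Space d := WithLp.toLp 2 fun i => Real.exp (y i)

/-- The coordinatewise logarithm, the inverse of `expMap` on the open orthant. -/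
def logMap (x : Space d) : Space d := WithLp.toLp 2 fun i => Real.log (x i)

@[simp]
theorem expMap_apply (y : Space d) (i : Fin d) : expMap y i = Real.exp (y i) := rfl

theorem isOpen_orthant : IsOpen (orthant d) := by
  have : orthant d = ⋂ i, {x : Space d | 0 < x i} := by ext; simp [orthant]
  rw [this]
  exact isOpen_iInter_of_finite fun i => isOpen_lt continuous_const (by fun_prop)

theorem expMap_mem_orthant (y : Space d) : expMap y ∈ orthant d := fun i => Real.exp_pos (y i)

@[simp]
theorem logMap_expMap (y : Space d) : logMap (expMap y) = y := by
  ext i; simp [logMap]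

theorem expMap_logMap {x : Space d} (hx : x ∈ orthant d) : expMap (logMap x) = x := by
  ext i; simp [logMap, Real.exp_log (hx i)]

theorem expMap_injective : Function.Injective (expMap (d := d)) :=
  Function.LeftInverse.injective logMap_expMap

theorem image_expMap_univ : expMap '' Set.univ = orthant d := by
  rw [Set.image_univ]
  exact Set.Subset.antisymm (Set.range_subset_iff.2 expMap_mem_orthant)
    fun x hx => ⟨logMap x, expMap_logMap hx⟩

theorem contDiff_expMap : ContDiff ℝ (⊤ : ℕ∞) (expMap (d := d)) := by
  rw [contDiff_piLp]
  intro i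
  simp only [expMap_apply]
  exact Real.contDiff_exp.comp (contDiff_piLp_apply (p := 2))

theorem contDiffOn_logMap : ContDiffOn ℝ (⊤ : ℕ∞) (logMap (d := d)) (orthant d) := by
  rw [contDiffOn_piLp]
  intro i
  exact (contDiff_piLp_apply (p := 2)).contDiffOn.log fun x hx => (hx i).ne'

theorem continuous_expMap : Continuous (expMap (d := d)) := contDiff_expMap.continuous

theorem hasFDerivAt_expMap (y : Space d) : HasFDerivAt expMap (fderiv ℝ expMap y) y :=
  (contDiff_expMap.differentiable (by simp) y).hasFDerivAt

theorem fderiv_expMap_apply (y h : Space d) (i : Fin d) :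
    fderiv ℝ expMap y h i = Real.exp (y i) * h i := by
  have h1 : HasFDerivAt (fun x : Space d => expMap x i)
      ((EuclideanSpace.proj i : Space d →L[ℝ] ℝ) ∘L fderiv ℝ expMap y) y :=
    (EuclideanSpace.proj i : Space d →L[ℝ] ℝ).hasFDerivAt.comp y (hasFDerivAt_expMap y)
  have h2 : HasFDerivAt (fun x : Space d => expMap x i)
      (Real.exp (y i) • (EuclideanSpace.proj i : Space d →L[ℝ] ℝ)) y :=
    ((EuclideanSpace.proj i : Space d →L[ℝ] ℝ).hasFDerivAt (x := y)).exp
  simpa using congrArg (fun L : Space d →L[ℝ] ℝ => L h) (h1.unique h2)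

/-- The exponential `y ↦ exp (∑ cₖ yₖ)`; a product of powers of coordinates, seen through
`expMap`. -/
def expWeight (c : Fin d → ℝ) (y : Space d) : ℝ := Real.exp (∑ k, c k * y k)

theorem contDiff_expWeight (c : Fin d → ℝ) : ContDiff ℝ (⊤ : ℕ∞) (expWeight c) :=
  Real.contDiff_exp.comp (ContDiff.sum fun _ _ =>
    contDiff_const.mul (contDiff_piLp_apply (p := 2)))

theorem expWeight_pos (c : Fin d → ℝ) (y : Space d) : 0 < expWeight c y := Real.exp_pos _

theorem expWeight_add (c c' : Fin d → ℝ) (y : Space d) :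
    expWeight (c + c') y = expWeight c y * expWeight c' y := by
  simp [expWeight, ← Real.exp_add, add_mul, Finset.sum_add_distrib]

theorem expWeight_neg (c : Fin d → ℝ) (y : Space d) :
    expWeight (-c) y = (expWeight c y)⁻¹ := by
  simp [expWeight, ← Real.exp_neg]

theorem expWeight_single (i : Fin d) (y : Space d) :
    expWeight (Pi.single i 1) y = Real.exp (y i) := by
  simp [expWeight, Pi.single_apply]

theorem partialDeriv_expWeight (c : Fin d → ℝ) (i : Fin d) (y : Space d) :
    partialDeriv i (expWeight c) y = c i * expWeight c y := by
  have h : HasFDerivAt (expWeight c) (expWeight c y •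
      ∑ k, c k • (EuclideanSpace.proj k : Space d →L[ℝ] ℝ)) y :=
    HasFDerivAt.exp (HasFDerivAt.fun_sum fun k _ =>
      ((EuclideanSpace.proj k : Space d →L[ℝ] ℝ).hasFDerivAt (x := y)).const_mul (c k))
  simp only [partialDeriv]
  rw [h.fderiv]
  simp [basisVec, mul_comm]

theorem partialDeriv_expWeight_mul (c : Fin d → ℝ) {θ : Space d → ℝ} {y : Space d}
    (hθ : DifferentiableAt ℝ θ y) (i : Fin d) :
    partialDeriv i (fun z => expWeight c z * θ z) y =
      expWeight c y * (partialDeriv i θ y + c i * θ y) := by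
  rw [partialDeriv_mul ((contDiff_expWeight c).differentiable (by simp) y) hθ,
    partialDeriv_expWeight]
  ring

theorem det_fderiv_expMap (y : Space d) : (fderiv ℝ expMap y).det = expWeight 1 y := by
  have h : LinearMap.toMatrix (EuclideanSpace.basisFun (Fin d) ℝ).toBasis
      (EuclideanSpace.basisFun (Fin d) ℝ).toBasis (fderiv ℝ expMap y : Space d →ₗ[ℝ] Space d) =
      Matrix.diagonal fun i => Real.exp (y i) := by
    ext i j
    rw [LinearMap.toMatrix_apply]
    simp [fderiv_expMap_apply, Matrix.diagonal_apply]
  rw [ContinuousLinearMap.det, ← LinearMap.det_toMatrix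
    (EuclideanSpace.basisFun (Fin d) ℝ).toBasis, h, Matrix.det_diagonal, ← Real.exp_sum]
  simp [expWeight]

theorem abs_det_fderiv_expMap (y : Space d) : |(fderiv ℝ expMap y).det| = expWeight 1 y := by
  rw [det_fderiv_expMap, abs_of_pos (expWeight_pos _ _)]

/-- Integrals over the orthant in logarithmic coordinates. -/
theorem setIntegral_orthant_eq (f : Space d → ℝ) :
    ∫ x in orthant d, f x = ∫ y, expWeight 1 y * f (expMap y) := by
  rw [← image_expMap_univ, integral_image_eq_integral_abs_det_fderiv_smul volume MeasurableSet.univ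
    (fun y _ => (hasFDerivAt_expMap y).hasFDerivWithinAt) expMap_injective.injOn]
  simp only [Measure.restrict_univ, abs_det_fderiv_expMap, smul_eq_mul]

/-- The Lebesgue measure on the orthant has the density `exp (∑ yₖ)` in logarithmic coordinates. -/
theorem map_expMap_withDensity {s : Set (Space d)} (hs : MeasurableSet s) :
    Measure.map expMap ((volume.restrict s).withDensity fun y => ENNReal.ofReal (expWeight 1 y)) =
      volume.restrict (expMap '' s) := by
  rw [← map_withDensity_abs_det_fderiv_eq_addHaar volume hs.nullMeasurableSet
    (fun y _ => (hasFDerivAt_expMap y).hasFDerivWithinAt) expMap_injective.injOn]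
  simp only [abs_det_fderiv_expMap]

theorem measurableEmbedding_expMap : MeasurableEmbedding (expMap (d := d)) :=
  continuous_expMap.measurableEmbedding expMap_injective

theorem ae_restrict_orthant_of_ae {p : Space d → Prop} (h : ∀ᵐ y : Space d, p (expMap y)) :
    ∀ᵐ x ∂volume.restrict (orthant d), p x := by
  rw [← image_expMap_univ, ← map_expMap_withDensity MeasurableSet.univ,
    measurableEmbedding_expMap.ae_map_iff]
  rw [Measure.restrict_univ]
  exact (withDensity_absolutelyContinuous volume _).ae_le h

theorem aestronglyMeasurable_restrict_image_expMap_iff {f : Space d → ℝ} {s : Set (Space d)}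
    (hs : MeasurableSet s) : AEStronglyMeasurable f (volume.restrict (expMap '' s)) ↔
      AEStronglyMeasurable (fun y => f (expMap y)) (volume.restrict s) := by
  rw [← map_expMap_withDensity hs, measurableEmbedding_expMap.aestronglyMeasurable_map_iff]
  refine ⟨fun h => h.mono_ac (withDensity_absolutelyContinuous' ?_ ?_),
    fun h => h.mono_ac (withDensity_absolutelyContinuous _ _)⟩
  · exact ((contDiff_expWeight 1).continuous.measurable.ennreal_ofReal).aemeasurable
  · exact Eventually.of_forall fun y => by simp [expWeight_pos]

theorem memLp_two_image_expMap_iff {f : Space d → ℝ} {K : Set (Space d)} (hK : IsCompact K) :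
    MemLp f 2 (volume.restrict (expMap '' K)) ↔
      MemLp (fun y => f (expMap y)) 2 (volume.restrict K) := by
  have hm := aestronglyMeasurable_restrict_image_expMap_iff (f := f) hK.measurableSet
  have key : IntegrableOn (fun x => f x ^ 2) (expMap '' K) ↔
      IntegrableOn (fun y => f (expMap y) ^ 2) K := by
    rw [integrableOn_image_iff_integrableOn_abs_det_fderiv_smul volume hK.measurableSet
      (fun y _ => (hasFDerivAt_expMap y).hasFDerivWithinAt) expMap_injective.injOn]
    simp only [abs_det_fderiv_expMap, smul_eq_mul]
    refine ⟨fun h => ?_,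
      fun h => h.continuousOn_mul (contDiff_expWeight 1).continuous.continuousOn hK⟩
    refine (h.continuousOn_mul (contDiff_expWeight (-1)).continuous.continuousOn hK).congr
      (Eventually.of_forall fun y => ?_)
    have := (expWeight_pos 1 y).ne'
    simp only [expWeight_neg]
    field_simp
  refine ⟨fun h => ?_, fun h => ?_⟩
  · exact (memLp_two_iff_integrable_sq (hm.1 h.1)).2
      (key.1 ((memLp_two_iff_integrable_sq h.1).1 h))
  · exact (memLp_two_iff_integrable_sq (hm.2 h.1)).2
      (key.2 ((memLp_two_iff_integrable_sq h.1).1 h))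

theorem memL2loc_orthant_iff {f : Space d → ℝ} :
    MemL2loc (orthant d) f ↔ MemL2loc Set.univ fun y => f (expMap y) := by
  refine ⟨fun h K _ hK => ?_, fun h K hKD hK => ?_⟩
  · refine (memLp_two_image_expMap_iff hK).1 (h _ ?_ (hK.image continuous_expMap))
    rintro _ ⟨y, -, rfl⟩
    exact expMap_mem_orthant y
  · have hK' : IsCompact (logMap '' K) :=
      hK.image_of_continuousOn (contDiffOn_logMap.continuousOn.mono hKD)
    have e : expMap '' (logMap '' K) = K := by
      rw [Set.image_image]
      exact (Set.image_congr fun x hx => expMap_logMap (hKD hx)).trans (Set.image_id' K)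
    have := (memLp_two_image_expMap_iff hK').2 (h _ (Set.subset_univ _) hK')
    rwa [e] at this

theorem IsTest.comp_expMap {φ : Space d → ℝ} (hφ : IsTest φ) (hs : tsupport φ ⊆ orthant d) :
    IsTest fun y => φ (expMap y) := by
  refine ⟨hφ.smooth.comp contDiff_expMap, HasCompactSupport.intro (K := logMap '' tsupport φ)
    (hφ.compact.isCompact.image_of_continuousOn (contDiffOn_logMap.continuousOn.mono hs))
    fun y hy => image_eq_zero_of_notMem_tsupport fun h => hy ⟨_, h, logMap_expMap y⟩⟩

/-- Every test function on the whole space is a test function on the orthant in logarithmic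
coordinates. -/
theorem exists_isTest_comp_expMap {θ : Space d → ℝ} (hθ : IsTest θ) :
    ∃ φ : Space d → ℝ, IsTest φ ∧ tsupport φ ⊆ orthant d ∧ ∀ y, φ (expMap y) = θ y := by
  classical
  set φ : Space d → ℝ := (orthant d).indicator fun x => θ (logMap x) with hφ
  have hK : IsCompact (expMap '' tsupport θ) := hθ.compact.isCompact.image continuous_expMap
  have hs : tsupport φ ⊆ expMap '' tsupport θ := by
    refine closure_minimal (fun x hx => ?_) hK.isClosed
    have hxD : x ∈ orthant d := Set.mem_of_indicator_ne_zero hx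
    rw [Function.mem_support, hφ, Set.indicator_of_mem hxD] at hx
    exact ⟨logMap x, subset_tsupport _ hx, expMap_logMap hxD⟩
  have hsD : tsupport φ ⊆ orthant d := hs.trans (by
    rintro _ ⟨y, -, rfl⟩
    exact expMap_mem_orthant y)
  refine ⟨φ, ⟨contDiff_iff_contDiffAt.2 fun x => ?_,
    HasCompactSupport.of_support_subset_isCompact hK
    ((subset_tsupport _).trans hs)⟩, hsD, fun y => ?_⟩
  · by_cases hx : x ∈ tsupport φ
    swap
    · refine (contDiffAt_const (c := 0)).congr_of_eventuallyEq ?_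
      exact notMem_tsupport_iff_eventuallyEq.1 hx
    have hD := isOpen_orthant.mem_nhds (hsD hx)
    refine (hθ.smooth.contDiffAt.comp x (contDiffOn_logMap.contDiffAt hD)).congr_of_eventuallyEq ?_
    filter_upwards [hD] with z hz
    simp [hφ, Set.indicator_of_mem hz]
  · simp [hφ, Set.indicator_of_mem (expMap_mem_orthant y)]

theorem partialDeriv_comp_expMap {φ : Space d → ℝ} (y : Space d)
    (hφ : DifferentiableAt ℝ φ (expMap y)) (i : Fin d) :
    partialDeriv i (fun z => φ (expMap z)) y = Real.exp (y i) * partialDeriv i φ (expMap y) := by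
  have h := hφ.hasFDerivAt.comp y (hasFDerivAt_expMap y)
  have e : fderiv ℝ expMap y (basisVec i) = Real.exp (y i) • basisVec i := by
    ext k
    rw [fderiv_expMap_apply]
    by_cases hk : k = i
    · subst hk; simp [basisVec]
    · simp [basisVec, hk]
  simp only [partialDeriv]
  erw [h.fderiv]
  simp [e]

/-- The partial derivatives on the orthant of a function given in logarithmic coordinates. -/
theorem exp_mul_partialDeriv_expMap {φ θ : Space d → ℝ} {c : Fin d → ℝ}
    (hφ : Differentiable ℝ φ) (hθ : Differentiable ℝ θ)
    (h : ∀ y, φ (expMap y) = expWeight c y * θ y) (i : Fin d) (y : Space d) :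
    Real.exp (y i) * partialDeriv i φ (expMap y) =
      expWeight c y * (partialDeriv i θ y + c i * θ y) := by
  rw [← partialDeriv_comp_expMap y (hφ _), ← partialDeriv_expWeight_mul c (hθ y)]
  simp only [h]

/-- Weak derivatives on the orthant, in logarithmic coordinates. -/
theorem HasWeakPartial.integral_comp_expMap {v g : Space d → ℝ} {i : Fin d}
    (h : HasWeakPartial (orthant d) i v g) {θ : Space d → ℝ} (hθ : IsTest θ) :
    ∫ y, v (expMap y) * partialDeriv i θ y = -∫ y, (Real.exp (y i) * g (expMap y)) * θ y := by
  -- The test function is `θ xᵢ / ∏ xₖ`: its derivative produces no zeroth order term.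
  obtain ⟨φ, hφ, hφs, hφθ⟩ :=
    exists_isTest_comp_expMap (hθ.mul_left (contDiff_expWeight (Pi.single i 1 - 1)))
  have hw (y : Space d) : expWeight 1 y * expWeight (Pi.single i 1 - 1) y = Real.exp (y i) := by
    rw [← expWeight_add, add_sub_cancel, expWeight_single]
  have hd (y : Space d) : partialDeriv i θ y = expWeight 1 y * partialDeriv i φ (expMap y) := by
    refine mul_left_cancel₀ (Real.exp_pos (y i)).ne' ?_
    have := exp_mul_partialDeriv_expMap (hφ.smooth.differentiable (by simp))
      (hθ.smooth.differentiable (by simp)) hφθ i y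
    rw [mul_left_comm, this, ← mul_assoc, hw]
    simp
  have h1 := h.integral_eq φ hφ.smooth hφ.compact hφs
  rw [setIntegral_orthant_eq, setIntegral_orthant_eq] at h1
  convert h1 using 1
  · refine integral_congr_ae (Eventually.of_forall fun y => ?_)
    simp only [hd y]
    ring
  · congr 1
    refine integral_congr_ae (Eventually.of_forall fun y => ?_)
    simp only
    rw [hφθ, ← hw]
    ring

/-- Conversely, a derivative of `xᵢ g` in logarithmic coordinates gives a weak derivative of `g` on
the orthant: `∂ⱼg = (xⱼ∂ⱼ(xᵢ g) - δᵢⱼ xᵢ g) / (xᵢ xⱼ)`. -/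
theorem hasWeakPartial_orthant_of_integral_comp_expMap {g H : Space d → ℝ} {i j : Fin d}
    (hg : MemL2loc (orthant d) g)
    (hh : MemL2loc (orthant d) fun x =>
      (x i * x j)⁻¹ * (H (logMap x) - (if j = i then x i * g x else 0)))
    (hH : MemL2loc Set.univ H)
    (h : ∀ θ, IsTest θ →
      ∫ y, (Real.exp (y i) * g (expMap y)) * partialDeriv j θ y = -∫ y, H y * θ y) :
    HasWeakPartial (orthant d) j g fun x =>
      (x i * x j)⁻¹ * (H (logMap x) - (if j = i then x i * g x else 0)) := by
  refine ⟨hg.locallyIntegrableOn isOpen_orthant, hh.locallyIntegrableOn isOpen_orthant,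
    fun φ hφ hc hs => ?_⟩
  have hφ' : IsTest φ := ⟨hφ, hc⟩
  -- `exp (∑ cₖ yₖ)` is the Jacobian of `expMap` divided by `xᵢ xⱼ`.
  set c : Fin d → ℝ := 1 - Pi.single i 1 - Pi.single j 1 with hcdef
  set θ : Space d → ℝ := fun y => expWeight c y * φ (expMap y) with hθdef
  have hθ : IsTest θ := (hφ'.comp_expMap hs).mul_left (contDiff_expWeight c)
  have hcw (y : Space d) : expWeight 1 y = Real.exp (y i) * (Real.exp (y j) * expWeight c y) := by
    rw [← expWeight_single, ← expWeight_single, ← expWeight_add, ← expWeight_add]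
    congr 1
    rw [hcdef]; abel
  have hcj : c j = -(if j = i then 1 else 0) := by
    simp [hcdef, Pi.single_apply]
  have hdθ (y : Space d) : partialDeriv j θ y + (if j = i then θ y else 0) =
      expWeight c y * (Real.exp (y j) * partialDeriv j φ (expMap y)) := by
    rw [hθdef,
      partialDeriv_expWeight_mul c ((hφ'.comp_expMap hs).smooth.differentiable (by simp) y),
      partialDeriv_comp_expMap y (hφ.differentiable (by simp) _), hcj]
    split_ifs <;> ring
  have hG : MemL2loc Set.univ fun y : Space d => Real.exp (y i) * g (expMap y) :=
    (memL2loc_orthant_iff.1 hg).continuousOn_mul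
      (Real.continuous_exp.comp (by fun_prop : Continuous fun y : Space d => y i)).continuousOn
  calc ∫ x in orthant d, g x * fderiv ℝ φ x (basisVec j)
      = ∫ y, ((Real.exp (y i) * g (expMap y)) * partialDeriv j θ y +
          (Real.exp (y i) * g (expMap y)) * (if j = i then θ y else 0)) := by
        rw [setIntegral_orthant_eq]
        refine integral_congr_ae (Eventually.of_forall fun y => ?_)
        simp only
        rw [← mul_add, hdθ, hcw]
        simp only [partialDeriv]
        ring
    _ = (∫ y, (Real.exp (y i) * g (expMap y)) * partialDeriv j θ y) +
          ∫ y, (Real.exp (y i) * g (expMap y)) * (if j = i then θ y else 0) := by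
        refine integral_add (hG.integrable_test (hθ.partialDeriv j)) ?_
        split_ifs
        · exact hG.integrable_test hθ
        · simp
    _ = -∫ y, (H y * θ y - (Real.exp (y i) * g (expMap y)) * (if j = i then θ y else 0)) := by
        rw [h θ hθ, integral_sub (hH.integrable_test hθ)]
        · ring
        · split_ifs
          · exact hG.integrable_test hθ
          · simp
    _ = _ := by
        rw [setIntegral_orthant_eq]
        congr 1
        refine integral_congr_ae (Eventually.of_forall fun y => ?_)
        simp only [logMap_expMap, expMap_apply]
        have h1 := (Real.exp_pos (y i)).ne'
        have h2 := (Real.exp_pos (y j)).ne'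
        rw [hcw, hθdef]
        split_ifs
        · field_simp
        · field_simp
          ring

/-! ### Weights, ellipticity and test functions -/

theorem weight_pos (γ : ℝ) (x : Space d) : 0 < weight γ x := by
  unfold weight; positivity

theorem contDiff_weight (γ : ℝ) : ContDiff ℝ (⊤ : ℕ∞) (weight (d := d) γ) :=
  (contDiff_const.add (contDiff_norm_sq ℝ)).rpow_const_of_ne fun x => by positivity

theorem MemL2loc.congr {U : Set (Space d)} {u v : Space d → ℝ} (hu : MemL2loc U u)
    (h : Set.EqOn u v U) : MemL2loc U v := by
  refine fun K hKU hK => (hu K hKU hK).ae_eq ?_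
  filter_upwards [ae_restrict_mem hK.measurableSet] with x hx using h (hKU hx)

theorem MemL2w.memL2loc {γ : ℝ} {u : Space d → ℝ} (hu : MemL2w γ u) : MemL2loc (orthant d) u := by
  have h1 : MemL2loc (orthant d) fun x => weight γ x * u x :=
    fun K hKD _ => hu.mono_measure (Measure.restrict_mono hKD le_rfl)
  have h2 : Continuous fun x : Space d => (weight γ x)⁻¹ :=
    (contDiff_weight γ).continuous.inv₀ fun x => (weight_pos γ x).ne'
  refine (h1.continuousOn_mul h2.continuousOn).congr fun x _ => ?_
  simp only
  rw [inv_mul_cancel_left₀ (weight_pos γ x).ne']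

theorem Market.isUnit_det_σ (M : Market d) : IsUnit M.σ.det := by
  have h := M.posDef.det_pos
  rw [Matrix.det_mul, Matrix.det_transpose] at h
  exact isUnit_iff_ne_zero.2 fun h0 => by simp [h0] at h

/-- The gradient itself is locally square integrable, since `σ` is invertible and the coordinates do
not vanish on the orthant. -/
theorem Market.HasH1w.memL2loc_grad {M : Market d} {γ : ℝ} {u : Space d → ℝ}
    {g : Fin d → Space d → ℝ} (h : M.HasH1w γ u g) (k : Fin d) : MemL2loc (orthant d) (g k) := by
  have h1 : MemL2loc (orthant d) fun x => ∑ i, M.σ⁻¹ k i * ∑ j, M.σ i j * x j * g j x :=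
    MemL2loc.sum fun i => (h.memL2w_grad i).memL2loc.const_mul _
  have h2 : ContinuousOn (fun x : Space d => (x k)⁻¹) (orthant d) :=
    ContinuousOn.inv₀ (by fun_prop) fun x hx => (hx k).ne'
  refine (h1.continuousOn_mul h2).congr fun x hx => ?_
  have e : ∑ i, M.σ⁻¹ k i * ∑ j, M.σ i j * x j * g j x = x k * g k x := by
    have := congrFun (congrArg (fun A : Matrix (Fin d) (Fin d) ℝ => A *ᵥ fun j => x j * g j x)
      (Matrix.nonsing_inv_mul M.σ M.isUnit_det_σ)) k
    simp only [← Matrix.mulVec_mulVec, Matrix.one_mulVec] at this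
    rw [← this]
    simp [Matrix.mulVec, dotProduct, mul_assoc]
  simp only [e]
  rw [inv_mul_cancel_left₀ (hx k).ne']

/-- The form `∑ aᵢⱼ ξᵢ ξⱼ` equals `|σᵀ ξ|²`, with `σᵀ` injective. -/
theorem Market.exists_ellipticity (M : Market d) : ∃ B : Space d →L[ℝ] Space d,
    Function.Injective B ∧ ∀ ξ : Space d, ∑ i, ∑ j, M.a i j * (ξ i * ξ j) = ‖B ξ‖ ^ 2 := by
  refine ⟨(Matrix.toEuclideanLin M.σᵀ).toContinuousLinearMap, ?_, fun ξ => ?_⟩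
  · rw [injective_iff_map_eq_zero]
    intro ξ hξ
    have h1 : M.σᵀ *ᵥ (ξ.ofLp) = 0 := by
      have := congrArg WithLp.ofLp hξ
      simpa using this
    have h2 : ξ.ofLp = 0 := Matrix.eq_zero_of_mulVec_eq_zero
      (by rw [Matrix.det_transpose]; exact M.isUnit_det_σ.ne_zero) h1
    ext i
    exact congrFun h2 i
  · rw [EuclideanSpace.norm_sq_eq]
    simp only [Market.a, Matrix.mul_apply, Matrix.transpose_apply, Finset.sum_mul]
    rw [Finset.sum_congr rfl fun i _ => Finset.sum_comm, Finset.sum_comm]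
    refine Finset.sum_congr rfl fun k _ => ?_
    have : ((Matrix.toEuclideanLin M.σᵀ).toContinuousLinearMap ξ) k = ∑ i, M.σ i k * ξ i := by
      simp [Matrix.mulVec, dotProduct]
    rw [this, Real.norm_eq_abs, sq_abs, sq, Finset.sum_mul_sum]
    refine Finset.sum_congr rfl fun i _ => Finset.sum_congr rfl fun j _ => ?_
    ring

theorem Market.a_comm (M : Market d) (i j : Fin d) : M.a i j = M.a j i := by
  simp [Market.a, Matrix.mul_apply, mul_comm]

theorem setIntegral_mul_eq_integral {U : Set (Space d)} (f : Space d → ℝ) {φ : Space d → ℝ}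
    (hs : tsupport φ ⊆ U) : ∫ x in U, f x * φ x = ∫ x, f x * φ x :=
  setIntegral_eq_integral_of_forall_compl_eq_zero fun x hx => by
    simp [image_eq_zero_of_notMem_tsupport fun h => hx (hs h)]

theorem HasWeakPartial.mono {U V : Set (Space d)} {i : Fin d} {u g : Space d → ℝ}
    (h : HasWeakPartial U i u g) (hVU : V ⊆ U) : HasWeakPartial V i u g := by
  refine ⟨h.locallyIntegrableOn.mono_set hVU, h.locallyIntegrableOn_deriv.mono_set hVU,
    fun φ hφ hc hs => ?_⟩
  have h1 := h.integral_eq φ hφ hc (hs.trans hVU)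
  have hs' := (tsupport_partialDeriv_subset φ i).trans hs
  rw [setIntegral_mul_eq_integral _ hs, setIntegral_mul_eq_integral u hs']
  rwa [setIntegral_mul_eq_integral _ (hs.trans hVU),
    setIntegral_mul_eq_integral u (hs'.trans hVU)] at h1

theorem IsTest.hasWeakPartial {φ : Space d → ℝ} (hφ : IsTest φ) (U : Set (Space d)) (i : Fin d) :
    HasWeakPartial U i φ (BlackScholes.partialDeriv i φ) := by
  have c1 := hφ.continuous
  have c2 := (hφ.partialDeriv i).continuous
  refine ⟨c1.locallyIntegrable.locallyIntegrableOn _, c2.locallyIntegrable.locallyIntegrableOn _,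
    fun θ hθ hc hθs => ?_⟩
  have hθ' : IsTest θ := ⟨hθ, hc⟩
  have hs' := (tsupport_partialDeriv_subset θ i).trans hθs
  rw [setIntegral_mul_eq_integral φ hs', setIntegral_mul_eq_integral _ hθs]
  refine integral_mul_fderiv_eq_neg_fderiv_mul_of_integrable ?_ ?_ ?_
    (fun x _ => hφ.smooth.differentiable (by simp) x) fun x _ => hθ.differentiable (by simp) x
  · exact (c2.mul hθ.continuous).integrable_of_hasCompactSupport
      (hφ.partialDeriv i).compact.mul_right
  · exact (c1.mul (hθ'.partialDeriv i).continuous).integrable_of_hasCompactSupport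
      hφ.compact.mul_right
  · exact (c1.mul hθ.continuous).integrable_of_hasCompactSupport hφ.compact.mul_right

theorem memLp_restrict_of_continuous {f : Space d → ℝ} (hf : Continuous f)
    (hc : HasCompactSupport f) (U : Set (Space d)) : MemLp f 2 (volume.restrict U) :=
  (hf.memLp_of_hasCompactSupport hc).restrict U

/-- Test functions, with their classical gradients, belong to the weighted Sobolev space. -/
theorem Market.hasH1w_of_isTest (M : Market d) (γ : ℝ) {φ : Space d → ℝ} (hφ : IsTest φ) :
    M.HasH1w γ φ fun i => partialDeriv i φ := by
  have hw := contDiff_weight (d := d) γ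
  refine ⟨?_, fun i => hφ.hasWeakPartial _ i, fun i => ?_⟩
  · have h := hφ.mul_left hw
    exact memLp_restrict_of_continuous h.continuous h.compact _
  · refine memLp_finsetSum (f := fun j x => weight γ x * (M.σ i j * x j * partialDeriv j φ x))
      Finset.univ (fun j _ => ?_) |>.ae_eq (Eventually.of_forall fun x => ?_)
    · have h1 : ContDiff ℝ (⊤ : ℕ∞) fun x : Space d => weight γ x * (M.σ i j * x j) :=
        hw.mul (contDiff_const.mul (contDiff_piLp_apply (p := 2)))
      have h := (hφ.partialDeriv j).mul_left h1
      refine (memLp_restrict_of_continuous h.continuous h.compact (orthant d)).ae_eq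
        (Eventually.of_forall fun x => ?_)
      simp only
      ring
    · simp [Finset.mul_sum]

/-! ### The variational equation in logarithmic coordinates -/

/-- The variational equation in logarithmic coordinates, where it has constant coefficients. The
weight disappears since the test function is divided by `ϱ²`. -/
theorem Market.form_eq_logarithmic (M : Market d) {γ : ℝ} {F : Space d → ℝ}
    {g : Fin d → Space d → ℝ} (hg : ∀ i, MemL2loc (orthant d) (g i))
    (hform : ∀ (φ : Space d → ℝ) (q : Fin d → Space d → ℝ), M.HasH1w γ φ q →
      M.form γ g φ q = ∫ x in orthant d, F x * φ x * weight γ x ^ 2)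
    {G : Fin d → Space d → ℝ} (hG : ∀ i y, G i y = Real.exp (y i) * g i (expMap y))
    {θ : Space d → ℝ} (hθ : IsTest θ) :
    (∑ i, (M.r - M.δ i) * ∫ y, G i y * θ y) -
      (1 / 2) * ∑ i, ∑ j, M.a i j *
        ((∫ y, G i y * partialDeriv j θ y) + if j = i then ∫ y, G i y * θ y else 0) =
      ∫ y, F (expMap y) * θ y := by
  -- `χ` is `θ` in logarithmic coordinates divided by the Jacobian of `expMap`.
  obtain ⟨χ, hχ, -, hχθ⟩ := exists_isTest_comp_expMap (hθ.mul_left (contDiff_expWeight (-1)))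
  have hw := contDiff_weight (d := d) γ
  have hw0 (x : Space d) : weight γ x ≠ 0 := (weight_pos γ x).ne'
  have hφ : IsTest fun x => χ x * (weight γ x ^ 2)⁻¹ :=
    hχ.mul_right ((hw.pow 2).inv fun x => pow_ne_zero 2 (hw0 x))
  have hGL (i) : MemL2loc Set.univ (G i) := by
    refine ((memL2loc_orthant_iff.1 (hg i)).continuousOn_mul
      (Real.continuous_exp.comp (by fun_prop : Continuous fun y : Space d => y i)).continuousOn)
      |>.congr fun y _ => (hG i y).symm
  have hone (y : Space d) : expWeight 1 y * expWeight (-1) y = 1 := by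
    rw [expWeight_neg, mul_inv_cancel₀ (expWeight_pos 1 y).ne']
  have hF : ∫ x in orthant d, F x * (χ x * (weight γ x ^ 2)⁻¹) * weight γ x ^ 2 =
      ∫ y, F (expMap y) * θ y := by
    rw [setIntegral_orthant_eq]
    refine integral_congr_ae (Eventually.of_forall fun y => ?_)
    simp only
    rw [hχθ, mul_assoc, mul_assoc, inv_mul_cancel₀ (pow_ne_zero 2 (hw0 _)), mul_one,
      mul_left_comm, ← mul_assoc (expWeight 1 y), hone, one_mul]
  have h1 (i : Fin d) : ∫ x in orthant d,
      (M.r - M.δ i) * x i * g i x * (χ x * (weight γ x ^ 2)⁻¹) * weight γ x ^ 2 =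
        (M.r - M.δ i) * ∫ y, G i y * θ y := by
    rw [setIntegral_orthant_eq, ← integral_const_mul]
    refine integral_congr_ae (Eventually.of_forall fun y => ?_)
    simp only
    rw [hχθ, mul_assoc _ _ (weight γ _ ^ 2), mul_assoc _ _ (weight γ _ ^ 2),
      inv_mul_cancel₀ (pow_ne_zero 2 (hw0 _)), mul_one, hG]
    calc _ = (expWeight 1 y * expWeight (-1) y) *
          ((M.r - M.δ i) * (Real.exp (y i) * g i (expMap y) * θ y)) := by
          rw [expMap_apply]; ring
      _ = _ := by rw [hone, one_mul]
  have h2 (i j : Fin d) : ∫ x in orthant d, M.a i j * g i x *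
      (x i * x j * weight γ x ^ 2 *
          partialDeriv j (fun z => χ z * (weight γ z ^ 2)⁻¹) x
        + χ x * (weight γ x ^ 2)⁻¹ *
          fderiv ℝ (fun y : Space d => y i * y j * weight γ y ^ 2) x (basisVec j)) =
      M.a i j * ((∫ y, G i y * partialDeriv j θ y) +
        if j = i then ∫ y, G i y * θ y else 0) := by
    -- `xᵢ xⱼ χ` is `exp (∑ cₖ yₖ) θ` in logarithmic coordinates.
    set c : Fin d → ℝ := Pi.single i 1 + Pi.single j 1 - 1 with hc
    have hcj : c j = if j = i then 1 else 0 := by simp [hc, Pi.single_apply]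
    have hcw (y : Space d) : expWeight 1 y * expWeight c y = Real.exp (y i) * Real.exp (y j) := by
      rw [← expWeight_single, ← expWeight_single, ← expWeight_add, ← expWeight_add]
      congr 1
      rw [hc]; abel
    have hcw' (y : Space d) :
        expWeight c y = Real.exp (y i) * Real.exp (y j) * expWeight (-1) y := by
      rw [← expWeight_single, ← expWeight_single, ← expWeight_add, ← expWeight_add]
      congr 1
    have sij : ContDiff ℝ (⊤ : ℕ∞) fun x : Space d => x i * x j :=
      (contDiff_piLp_apply (p := 2)).mul (contDiff_piLp_apply (p := 2))
    -- the product rule for `∂ⱼ(xᵢ xⱼ ϱ² φ)`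
    have hprod (x : Space d) : x i * x j * weight γ x ^ 2 *
          partialDeriv j (fun z => χ z * (weight γ z ^ 2)⁻¹) x
        + χ x * (weight γ x ^ 2)⁻¹ *
          fderiv ℝ (fun y : Space d => y i * y j * weight γ y ^ 2) x (basisVec j) =
        partialDeriv j (fun z => z i * z j * χ z) x := by
      have e : (fun z : Space d => z i * z j * χ z) =
          fun z => (z i * z j * weight γ z ^ 2) * (χ z * (weight γ z ^ 2)⁻¹) := by
        ext z
        have := hw0 z
        field_simp
      rw [e, partialDeriv_mul ((sij.mul (hw.pow 2)).differentiable (by simp) x)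
        (hφ.smooth.differentiable (by simp) x)]
      ring
    have hd (y : Space d) : expWeight 1 y *
        partialDeriv j (fun z : Space d => z i * z j * χ z) (expMap y) =
          Real.exp (y i) * (partialDeriv j θ y + c j * θ y) := by
      have := exp_mul_partialDeriv_expMap (φ := fun z : Space d => z i * z j * χ z)
        (θ := θ) (c := c)
        ((sij.mul hχ.smooth).differentiable (by simp)) (hθ.smooth.differentiable (by simp))
        (fun y => by rw [hχθ, hcw']; simp only [expMap_apply]; ring) j y
      refine mul_left_cancel₀ (Real.exp_pos (y j)).ne' ?_
      rw [mul_left_comm, this, ← mul_assoc, hcw]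
      ring
    rw [setIntegral_orthant_eq]
    simp only [hprod]
    have e1 : ∫ y, (G i y * partialDeriv j θ y + G i y * (c j * θ y)) =
        (∫ y, G i y * partialDeriv j θ y) + if j = i then ∫ y, G i y * θ y else 0 := by
      rw [hcj, integral_add ((hGL i).integrable_test (hθ.partialDeriv j))]
      · split_ifs <;> simp
      · split_ifs
        · simpa using (hGL i).integrable_test hθ
        · simp
    rw [← e1, ← integral_const_mul]
    refine integral_congr_ae (Eventually.of_forall fun y => ?_)
    simp only
    rw [← mul_add, hG, mul_left_comm, hd]
    ring
  have h := hform _ _ (M.hasH1w_of_isTest γ hφ)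
  rw [hF] at h
  rw [← h, Market.form]
  congr 1
  · exact Finset.sum_congr rfl fun i _ => (h1 i).symm
  · congr 1
    exact Finset.sum_congr rfl fun i _ => Finset.sum_congr rfl fun j _ => (h2 i j).symm

/-! ### Regularity of variational solutions -/

theorem memH2Loc_of_memL2loc {D : Set (Space d)} {v : Space d → ℝ} {g : Fin d → Space d → ℝ}
    {h : Fin d → Fin d → Space d → ℝ} (hv : MemL2loc D v) (hg : ∀ i, MemL2loc D (g i))
    (hh : ∀ i j, MemL2loc D (h i j)) (hvg : ∀ i, HasWeakPartial D i v (g i))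
    (hgh : ∀ i j, HasWeakPartial D j (g i) (h i j)) : MemH2Loc D v := by
  intro U _ hU hUD
  have hUD' : U ⊆ D := subset_closure.trans hUD
  have key {f : Space d → ℝ} (hf : MemL2loc D f) : MemLp f 2 (volume.restrict U) :=
    (hf _ hUD hU).mono_measure (Measure.restrict_mono subset_closure le_rfl)
  exact ⟨key hv, g, h, fun i => ⟨(hvg i).mono hUD', key (hg i)⟩,
    fun i j => ⟨(hgh i j).mono hUD', key (hh i j)⟩⟩

/-- Interior regularity for the Black-Scholes operator: if `v` has weak gradient `g` and solves the
variational equation with a locally square integrable right-hand side `F`, then it has locally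
square integrable second order weak derivatives and solves the equation almost everywhere. -/
theorem Market.exists_second_weak_derivatives (M : Market d) {γ : ℝ} {v F : Space d → ℝ}
    {g : Fin d → Space d → ℝ} (hv : MemL2loc (orthant d) v)
    (hg : ∀ i, MemL2loc (orthant d) (g i)) (hF : MemL2loc (orthant d) F)
    (hvg : ∀ i, HasWeakPartial (orthant d) i v (g i))
    (hform : ∀ (φ : Space d → ℝ) (q : Fin d → Space d → ℝ), M.HasH1w γ φ q →
      M.form γ g φ q = ∫ x in orthant d, F x * φ x * weight γ x ^ 2) :
    ∃ h : Fin d → Fin d → Space d → ℝ, (∀ i j, MemL2loc (orthant d) (h i j)) ∧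
      (∀ i j, HasWeakPartial (orthant d) j (g i) (h i j)) ∧
      ∀ᵐ x ∂volume.restrict (orthant d), M.op x (fun i => g i x) (fun i j => h i j x) = F x := by
  obtain ⟨B, hinj, hB⟩ := M.exists_ellipticity
  set G : Fin d → Space d → ℝ := fun i y => Real.exp (y i) * g i (expMap y) with hG
  have hGL (i) : MemL2loc Set.univ (G i) := (memL2loc_orthant_iff.1 (hg i)).continuousOn_mul
    (Real.continuous_exp.comp (by fun_prop : Continuous fun y : Space d => y i)).continuousOn
  have hFL := memL2loc_orthant_iff.1 hF
  have heq {θ : Space d → ℝ} (hθ : IsTest θ) :=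
    M.form_eq_logarithmic hg hform (G := G) (fun _ _ => rfl) hθ
  have hGF (θ) (hθ : IsTest θ) : ∑ i, ∑ j, M.a i j * ∫ y, G j y * partialDeriv i θ y =
      ∫ y, ((∑ i, (2 * (M.r - M.δ i) - M.a i i) * G i y) + -2 * F (expMap y)) * θ y := by
    have e1 : ∫ y, ((∑ i, (2 * (M.r - M.δ i) - M.a i i) * G i y) + -2 * F (expMap y)) * θ y =
        (∑ i, (2 * (M.r - M.δ i) - M.a i i) * ∫ y, G i y * θ y) +
          -2 * ∫ y, F (expMap y) * θ y := by
      have i1 (i) := ((hGL i).integrable_test hθ).const_mul (2 * (M.r - M.δ i) - M.a i i)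
      simp only [← integral_const_mul]
      rw [← integral_finsetSum _ fun i _ => i1 i,
        ← integral_add (integrable_finsetSum _ fun i _ => i1 i)
          ((hFL.integrable_test hθ).const_mul _)]
      refine integral_congr_ae (Eventually.of_forall fun y => ?_)
      simp only [add_mul, Finset.sum_mul, mul_assoc]
    have e2 : ∑ i, ∑ j, M.a i j * ∫ y, G j y * partialDeriv i θ y =
        ∑ i, ∑ j, M.a i j * ∫ y, G i y * partialDeriv j θ y := by
      rw [Finset.sum_comm]
      exact Finset.sum_congr rfl fun i _ => Finset.sum_congr rfl fun j _ => by rw [M.a_comm]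
    have h := heq hθ
    simp only [mul_add, Finset.sum_add_distrib, mul_ite, mul_zero, Finset.sum_ite_eq',
      Finset.mem_univ, if_true] at h
    rw [e1, e2, ← h]
    simp only [sub_mul, Finset.sum_sub_distrib, mul_assoc, ← Finset.mul_sum]
    ring
  have hsecond := exists_memL2loc_second_weak_derivative B hinj hB
    (memL2loc_orthant_iff.1 hv) hGL
    ((MemL2loc.sum fun i => (hGL i).const_mul (2 * (M.r - M.δ i) - M.a i i)).add
      (hFL.const_mul (-2)))
    (fun i θ hθ => (hvg i).integral_comp_expMap hθ) hGF
  choose H hH hHθ using hsecond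
  set h : Fin d → Fin d → Space d → ℝ := fun i j x =>
    (x i * x j)⁻¹ * (H j i (logMap x) - (if j = i then x i * g i x else 0)) with hh
  have hxh (i j : Fin d) (y : Space d) :
      Real.exp (y i) * Real.exp (y j) * h i j (expMap y) =
        H j i y - if j = i then G i y else 0 := by
    have h1 := (Real.exp_pos (y i)).ne'
    have h2 := (Real.exp_pos (y j)).ne'
    simp only [hh, hG, logMap_expMap, expMap_apply]
    rw [mul_inv_cancel_left₀ (mul_ne_zero h1 h2)]
  have hhL (i j) : MemL2loc (orthant d) (h i j) := by
    rw [memL2loc_orthant_iff]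
    have hL : MemL2loc Set.univ fun y => H j i y + (if j = i then -1 else 0) * G i y :=
      (hH j i).add ((hGL i).const_mul _)
    have hc : Continuous fun y : Space d => (Real.exp (y i) * Real.exp (y j))⁻¹ :=
      ((Real.continuous_exp.comp (by fun_prop : Continuous fun y : Space d => y i)).mul
        (Real.continuous_exp.comp (by fun_prop : Continuous fun y : Space d => y j))).inv₀
        fun y => mul_ne_zero (Real.exp_ne_zero _) (Real.exp_ne_zero _)
    refine (hL.continuousOn_mul hc.continuousOn).congr fun y _ => ?_
    have h3 := hxh i j y
    have h4 : Real.exp (y i) * Real.exp (y j) ≠ 0 := by positivity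
    simp only
    rw [← mul_right_inj' h4, mul_inv_cancel_left₀ h4, h3]
    split_ifs <;> ring
  have hgh (i j) : HasWeakPartial (orthant d) j (g i) (h i j) :=
    hasWeakPartial_orthant_of_integral_comp_expMap (hg i) (hhL i j) (hH j i) (hHθ j i)
  refine ⟨h, hhL, hgh, ae_restrict_orthant_of_ae ?_⟩
  -- In logarithmic coordinates the equation holds against all test functions.
  set E : Space d → ℝ := fun y => ((∑ i, (M.r - M.δ i) * G i y) +
    (1 / 2) * ∑ i, ∑ j, M.a i j * (H j i y + (if j = i then -1 else 0) * G i y)) +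
      -1 * F (expMap y) with hE
  have hHL (i j) : MemL2loc Set.univ fun y => H j i y + (if j = i then -1 else 0) * G i y :=
    (hH j i).add ((hGL i).const_mul _)
  have hEL : MemL2loc Set.univ E :=
    ((MemL2loc.sum fun i => (hGL i).const_mul _).add ((MemL2loc.sum fun i => MemL2loc.sum fun j =>
      (hHL i j).const_mul (M.a i j)).const_mul _)).add (hFL.const_mul _)
  have hE0 : ∀ᵐ y, E y = 0 := by
    refine ae_eq_zero_of_integral_contDiff_smul_eq_zero hEL.locallyIntegrable fun θ hθs hθc => ?_
    have hθ : IsTest θ := ⟨hθs, hθc⟩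
    have i1 (i) := ((hGL i).integrable_test hθ).const_mul (M.r - M.δ i)
    have i2 (i j) := (hHL i j).integrable_test hθ
    have i3 := (hFL.integrable_test hθ).const_mul (-1)
    have e1 (i j : Fin d) :
        ∫ y, (H j i y + (if j = i then -1 else 0) * G i y) * θ y =
          -((∫ y, G i y * partialDeriv j θ y) + if j = i then ∫ y, G i y * θ y else 0) := by
      have : ∀ y, (H j i y + (if j = i then -1 else 0) * G i y) * θ y =
          H j i y * θ y + (if j = i then -1 else 0) * (G i y * θ y) := fun y => by ring
      simp only [this]
      rw [integral_add ((hH j i).integrable_test hθ)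
        (((hGL i).integrable_test hθ).const_mul _), integral_const_mul, hHθ j i θ hθ]
      split_ifs <;> ring
    calc ∫ y, θ y • E y = ∫ y, (((∑ i, (M.r - M.δ i) * (G i y * θ y)) +
          (1 / 2) * ∑ i, ∑ j, M.a i j *
            ((H j i y + (if j = i then -1 else 0) * G i y) * θ y)) +
          -1 * (F (expMap y) * θ y)) := by
          refine integral_congr_ae (Eventually.of_forall fun y => ?_)
          simp only [hE, smul_eq_mul, ← mul_assoc, ← Finset.sum_mul]
          ring
      _ = (∑ i, (M.r - M.δ i) * ∫ y, G i y * θ y) + (1 / 2) * ∑ i, ∑ j, M.a i j *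
            (∫ y, (H j i y + (if j = i then -1 else 0) * G i y) * θ y) +
          -1 * ∫ y, F (expMap y) * θ y := by
          have i2' := (integrable_sum_sum_const_mul (fun i j => M.a i j) i2).const_mul (1 / 2)
          have i1' := integrable_finsetSum Finset.univ fun i _ => i1 i
          rw [integral_add (by exact i1'.add i2') i3, integral_add i1' i2', integral_const_mul,
            integral_const_mul, integral_finsetSum _ fun i _ => i1 i,
            integral_sum_sum_const_mul (fun i j => M.a i j) i2]
          simp only [integral_const_mul]
      _ = 0 := by
          have := heq hθ
          simp only [e1, mul_neg, Finset.sum_neg_distrib]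
          linarith
  filter_upwards [hE0] with y hy
  have e1 : M.op (expMap y) (fun i => g i (expMap y)) (fun i j => h i j (expMap y)) =
      (∑ i, (M.r - M.δ i) * G i y) +
        (1 / 2) * ∑ i, ∑ j, M.a i j * (H j i y + (if j = i then -1 else 0) * G i y) := by
    rw [Market.op]
    congr 1
    · exact Finset.sum_congr rfl fun i _ => by simp only [hG, expMap_apply]; ring
    · congr 1
      refine Finset.sum_congr rfl fun i _ => Finset.sum_congr rfl fun j _ => ?_
      simp only [expMap_apply]
      rw [mul_assoc, mul_assoc, ← mul_assoc (Real.exp (y i)), hxh]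
      split_ifs <;> ring
  rw [e1]
  simp only [hE] at hy
  linarith

end BlackScholes

end

theorem mainTheorem8 {d : ℕ} (M : BlackScholes.Market d)
    {Ω : Type*} [MeasurableSpace Ω] (P : Measure Ω) [IsProbabilityMeasure P]
    (W : Fin d → ℝ≥0 → Ω → ℝ) (hW : BlackScholes.IsWiener W P)
    (γ : ℝ) (hγ : (2 + (d : ℝ)) / 4 < γ)
    (ψ : BlackScholes.Space d → ℝ) (hA1 : BlackScholes.IsPayoff ψ)
    (hA2 : M.Discounted ψ P W) (hΨ : M.LinearGrowth ψ)
    (v : BlackScholes.Space d → ℝ) (hv : M.IsVariationalSolution γ ψ v) :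
    BlackScholes.MemH2Loc (BlackScholes.orthant d) v ∧
      ∃ (g : Fin d → BlackScholes.Space d → ℝ)
        (h : Fin d → Fin d → BlackScholes.Space d → ℝ),
        (∀ i, BlackScholes.HasWeakPartial (BlackScholes.orthant d) i v (g i)) ∧
        (∀ i j, BlackScholes.HasWeakPartial (BlackScholes.orthant d) j (g i) (h i j)) ∧
        ∀ᵐ x ∂volume.restrict (BlackScholes.orthant d),
          M.op x (fun i => g i x) (fun i j => h i j x) = M.r * v x - M.Phi ψ x (v x) := by
  obtain ⟨g, hvg, -, hΦ, hform⟩ := hv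
  have hv := hvg.memL2w.memL2loc
  have hF : BlackScholes.MemL2loc (BlackScholes.orthant d)
      fun x => M.r * v x - M.Phi ψ x (v x) :=
    ((hv.const_mul M.r).add (hΦ.memL2loc.const_mul (-1))).congr fun x _ => by
      simp only
      ring
  obtain ⟨h, hh, hgh, heq⟩ := M.exists_second_weak_derivatives hv hvg.memL2loc_grad hF
    hvg.weakPartial hform
  exact ⟨BlackScholes.memH2Loc_of_memL2loc hv hvg.memL2loc_grad hh hvg.weakPartial hgh,
    g, h, hvg.weakPartial, hgh, heq⟩
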